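/- Let $C=\mathbb{R}+e\mathbb{R}$, $e^2=1$, be the algebra of para-complex numbers. Let $(M,I)$ be a para-complex manifold: $M$ is a smooth manifold and $I$ a smooth field of endomorphisms of $TM$ with $I^2=\mathrm{Id}$, $I_x\neq\pm\mathrm{Id}$, whose eigendistributions $\ker(I\mp\mathrm{Id})$ have equal rank and are integrable. Let $g$ be a para-Norden metric on it, i.e. a smooth symmetric non-degenerate 2-tensor with $g(IX,IY)=g(X,Y)$, and suppose that $(M,I,g)$ is para-Kähler Norden, i.e. $\nabla I=0$ for the Levi-Civita connection $\nabla$ of $g$. For a real tangent vector $X$ put $\widehat X=\tfrac12(X+eIX)\in T^{1,0}M=\{Z\in TM\otimes_{\mathbb R}C: IZ=eZ\}$. Let $\widehat g$ be the $C$-bilinear metric on $T_CM=TM\otimes_{\mathbb R}C$ determined by $$\widehat g(\widehat X,\widehat Y)=\tfrac12\big(g(X,Y)+e\,g(X,IY)\big),\qquad \widehat g(\overline Z,\overline W)=\overline{\widehat g(Z,W)},\qquad \widehat g(T^{1,0}M,T^{0,1}M)=0,$$ where $T^{0,1}M=\{Z: IZ=-eZ\}$. Let $R$ and $\widehat R$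 be the curvature tensors of the Levi-Civita connections of $g$ (on $TM$) and of $\widehat g$ (on $T_CM$). Then $\widehat R(Z_1,Z_2)Z_3\in T^{1,0}M$ for $Z_1,Z_2,Z_3\in T^{1,0}M$. Define the Ricci tensors $$\mathrm{Ric}(g)(X,Y)=\mathrm{Tr}_{\mathbb R}\{Z\mapsto R(Z,X)Y\},\qquad \mathrm{Ric}(\widehat g)(\widehat X,\widehat Y)=\mathrm{Tr}_{C}\{\widehat Z\mapsto \widehat R(\widehat Z,\widehat X)\widehat Y\}$$ (the second trace is taken over $T^{1,0}M$), the Ricci operators $Q$ on $TM$ and $\widehat Q$ on $T^{1,0}M$ by $g(QX,Y)=\mathrm{Ric}(g)(X,Y)$ and $\widehat g(\widehat Q\widehat X,\widehat Y)=\mathrm{Ric}(\widehat g)(\widehat X,\widehat Y)$, and the scalar curvatures $K=\mathrm{Tr}_{\mathbb R}\,Q$, $K^*=\mathrm{Tr}_{\mathbb R}(IQ)$ and $\widehat K=\mathrm{Tr}_{C}\,\widehat Q$. Then, at every point of $M$, $$\widehat K=\tfrac12\,(K+eK^*).$$ -/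

import Mathlib

open scoped Manifold ContDiff TensorProduct
open Bundle

noncomputable section

/-! ## Para-complex numbers -/

/-- The algebra `C = ℝ + eℝ` of para-complex numbers, `e² = 1`. -/
abbrev ParaComplex : Type := QuadraticAlgebra ℝ 1 0

namespace ParaComplex

/-- The para-complex unit `e`, with `e² = 1`. -/
abbrev e : ParaComplex := QuadraticAlgebra.omega

/-- Para-complex conjugation `x + ey ↦ x - ey`. -/
def conj : ParaComplex →ₗ[ℝ] ParaComplex where
  toFun z := ⟨z.re, -z.im⟩
  map_add' z w := by ext <;> simp [add_comm]
  map_smul' r z := by ext <;> simp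

/-- The real part as a real-linear map. -/
def reL : ParaComplex →ₗ[ℝ] ℝ where
  toFun z := z.re
  map_add' _ _ := rfl
  map_smul' _ _ := rfl

/-- The imaginary part as a real-linear map. -/
def imL : ParaComplex →ₗ[ℝ] ℝ where
  toFun z := z.im
  map_add' _ _ := rfl
  map_smul' _ _ := rfl

end ParaComplex

/-! ## Para-complexification of a real vector space -/

section Complexification

variable (V : Type*) [AddCommGroup V] [Module ℝ V]

/-- The para-complexification `V ⊗ C`. -/
abbrev ParaComplexification : Type _ := ParaComplex ⊗[ℝ] V

namespace ParaComplexification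

/-- The real part of an element of `V ⊗ C = V ⊕ eV`. -/
def rePart : ParaComplexification V →ₗ[ℝ] V :=
  (TensorProduct.lid ℝ V).toLinearMap ∘ₗ LinearMap.rTensor V ParaComplex.reL

/-- The imaginary part of an element of `V ⊗ C = V ⊕ eV`. -/
def imPart : ParaComplexification V →ₗ[ℝ] V :=
  (TensorProduct.lid ℝ V).toLinearMap ∘ₗ LinearMap.rTensor V ParaComplex.imL

/-- Conjugation on `V ⊗ C`. -/
def conj : ParaComplexification V →ₗ[ℝ] ParaComplexification V :=
  LinearMap.rTensor V ParaComplex.conj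

variable {V}

@[simp] theorem rePart_tmul (a : ParaComplex) (v : V) : rePart V (a ⊗ₜ v) = a.re • v := rfl

@[simp] theorem imPart_tmul (a : ParaComplex) (v : V) : imPart V (a ⊗ₜ v) = a.im • v := rfl

theorem eq_re_add_im (Z : ParaComplexification V) :
    Z = (1 : ParaComplex) ⊗ₜ[ℝ] rePart V Z + ParaComplex.e ⊗ₜ[ℝ] imPart V Z := by
  induction Z using TensorProduct.induction_on with
  | zero => simp
  | tmul a v =>
    rw [rePart_tmul, imPart_tmul, ← TensorProduct.smul_tmul, ← TensorProduct.smul_tmul,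
      ← TensorProduct.add_tmul]
    congr 1
    ext <;> simp [QuadraticAlgebra.re_one, QuadraticAlgebra.im_one]
  | add Z W hZ hW =>
    conv_lhs => rw [hZ, hW]
    simp only [map_add, TensorProduct.tmul_add]
    abel

theorem rePart_smul (c : ParaComplex) (Z : ParaComplexification V) :
    rePart V (c • Z) = c.re • rePart V Z + c.im • imPart V Z := by
  induction Z using TensorProduct.induction_on with
  | zero => simp
  | tmul a v => simp [TensorProduct.smul_tmul', add_smul, mul_smul]
  | add Z W hZ hW => simp only [smul_add, map_add, hZ, hW]; abel

theorem imPart_smul (c : ParaComplex) (Z : ParaComplexification V) :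
    imPart V (c • Z) = c.re • imPart V Z + c.im • rePart V Z := by
  induction Z using TensorProduct.induction_on with
  | zero => simp
  | tmul a v => simp [TensorProduct.smul_tmul', add_smul, mul_smul]
  | add Z W hZ hW => simp only [smul_add, map_add, hZ, hW]; abel

theorem rePart_baseChange (J : V →ₗ[ℝ] V) (Z : ParaComplexification V) :
    rePart V (J.baseChange ParaComplex Z) = J (rePart V Z) := by
  induction Z using TensorProduct.induction_on with
  | zero => simp
  | tmul a v => simp
  | add Z W hZ hW => simp only [map_add, hZ, hW]

theorem imPart_baseChange (J : V →ₗ[ℝ] V) (Z : ParaComplexification V) :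
    imPart V (J.baseChange ParaComplex Z) = J (imPart V Z) := by
  induction Z using TensorProduct.induction_on with
  | zero => simp
  | tmul a v => simp
  | add Z W hZ hW => simp only [map_add, hZ, hW]

end ParaComplexification

end Complexification

/-! ## Para-Norden vector spaces (the tangent spaces of a para-Norden manifold) -/

/-- A para-complex vector space `(V, J)` (`J² = id`, `J ≠ ± id`, eigenspaces of equal dimension)
with a symmetric non-degenerate real bilinear form `B` such that `B (JX, JY) = B (X, Y)`. -/
structure ParaNordenSpace (V : Type*) [AddCommGroup V] [Module ℝ V] where
  J : V →ₗ[ℝ] V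
  B : LinearMap.BilinForm ℝ V
  J_sq : ∀ X, J (J X) = X
  J_ne_id : J ≠ LinearMap.id
  J_ne_neg_id : J ≠ -LinearMap.id
  finrank_eq : Module.finrank ℝ (LinearMap.ker (LinearMap.id - J)) =
    Module.finrank ℝ (LinearMap.ker (LinearMap.id + J))
  B_symm : ∀ X Y, B X Y = B Y X
  B_nondegenerate : ∀ X, (∀ Y, B X Y = 0) → X = 0
  B_J : ∀ X Y, B (J X) (J Y) = B X Y

namespace ParaNordenSpace

open ParaComplex ParaComplexification

variable {V : Type*} [AddCommGroup V] [Module ℝ V] (P : ParaNordenSpace V)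

theorem B_nondeg : P.B.Nondegenerate :=
  ⟨P.B_nondegenerate, fun Y hY => P.B_nondegenerate Y fun X => by rw [P.B_symm]; exact hY X⟩

/-- The `C`-linear extension of `J` to `V ⊗ C`. -/
def JC : ParaComplexification V →ₗ[ParaComplex] ParaComplexification V :=
  P.J.baseChange ParaComplex

/-- `V^{1,0} = {Z ∈ V ⊗ C | JZ = eZ}`. -/
def T10 : Submodule ParaComplex (ParaComplexification V) :=
  LinearMap.ker (P.JC - e • LinearMap.id)

theorem mem_T10 (Z : ParaComplexification V) : Z ∈ P.T10 ↔ P.JC Z = e • Z := by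
  simp [T10, sub_eq_zero]

theorem JC_JC (Z : ParaComplexification V) : P.JC (P.JC Z) = Z := by
  have h : P.J ∘ₗ P.J = LinearMap.id := LinearMap.ext P.J_sq
  have := congrArg (LinearMap.baseChange ParaComplex) h
  rw [LinearMap.baseChange_comp, LinearMap.baseChange_id] at this
  exact LinearMap.congr_fun this Z

theorem e_mul_e : (e * e : ParaComplex) = 1 := by
  ext <;> simp [QuadraticAlgebra.re_one, QuadraticAlgebra.im_one]

/-- The projection of `V ⊗ C` onto `V^{1,0}` along `V^{0,1}`, `Z ↦ ½ (Z + e JZ)`. -/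
def proj10 : ParaComplexification V →ₗ[ParaComplex] P.T10 :=
  LinearMap.codRestrict P.T10
    ((algebraMap ℝ ParaComplex (1 / 2)) • (LinearMap.id + e • P.JC)) fun Z => by
      rw [mem_T10]
      simp only [LinearMap.smul_apply, LinearMap.add_apply, LinearMap.id_apply, map_smul, map_add,
        P.JC_JC]
      rw [smul_comm e, smul_add e Z, smul_smul e e, e_mul_e, one_smul, add_comm]

/-- `X̂ = ½ (X + e JX) ∈ V^{1,0}`. -/
def hat (X : V) : P.T10 := P.proj10 ((1 : ParaComplex) ⊗ₜ[ℝ] X)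

/-- For `Z ∈ V^{1,0}`, the unique real vector `X` with `Z = X̂`. -/
def unhat (Z : P.T10) : V := (2 : ℝ) • rePart V (Z : ParaComplexification V)

theorem imPart_T10 (Z : P.T10) : imPart V (Z : ParaComplexification V) = P.J (rePart V Z) := by
  have h := congrArg (imPart V) ((P.mem_T10 Z).1 Z.2)
  rw [JC, imPart_baseChange, imPart_smul] at h
  simp only [QuadraticAlgebra.omega_re, QuadraticAlgebra.omega_im, zero_smul, one_smul,
    zero_add] at h
  rw [← h, P.J_sq]

theorem unhat_hat (X : V) : P.unhat (P.hat X) = X := by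
  have h : ((P.hat X : P.T10) : ParaComplexification V) = algebraMap ℝ ParaComplex (1 / 2) •
      ((1 : ParaComplex) ⊗ₜ[ℝ] X + e • ((1 : ParaComplex) ⊗ₜ[ℝ] P.J X)) := rfl
  rw [unhat, h, rePart_smul, map_add, map_add, rePart_smul, imPart_smul]
  simp [QuadraticAlgebra.re_one, QuadraticAlgebra.im_one, smul_smul]

theorem unhat_injective : Function.Injective P.unhat := by
  intro Z W h
  have h1 : rePart V (Z : ParaComplexification V) = rePart V (W : ParaComplexification V) :=
    smul_right_injective V (two_ne_zero (α := ℝ)) h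
  apply Subtype.ext
  rw [eq_re_add_im (Z : ParaComplexification V), eq_re_add_im (W : ParaComplexification V),
    P.imPart_T10, P.imPart_T10, h1]

theorem hat_unhat (Z : P.T10) : P.hat (P.unhat Z) = Z :=
  P.unhat_injective (P.unhat_hat _)

theorem unhat_add (Z W : P.T10) : P.unhat (Z + W) = P.unhat Z + P.unhat W := by
  simp [unhat, smul_add]

theorem unhat_smul (c : ParaComplex) (Z : P.T10) :
    P.unhat (c • Z) = c.re • P.unhat Z + c.im • P.J (P.unhat Z) := by
  simp only [unhat, Submodule.coe_smul, rePart_smul, imPart_T10, map_smul, smul_add]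
  rw [smul_comm (2 : ℝ) c.re, smul_comm (2 : ℝ) c.im]

theorem B_J_left (X Y : V) : P.B (P.J X) Y = P.B X (P.J Y) := by
  rw [← P.B_J X, P.J_sq]

/-- The para-complex metric on `V^{1,0}`:
`ĝ(X̂, Ŷ) = ½ (g(X, Y) + e g(X, JY))`. -/
def form10 : LinearMap.BilinForm ParaComplex P.T10 :=
  LinearMap.mk₂ ParaComplex
    (fun Z W => ⟨1 / 2 * P.B (P.unhat Z) (P.unhat W), 1 / 2 * P.B (P.unhat Z) (P.J (P.unhat W))⟩)
    (fun Z Z' W => by ext <;> simp [unhat_add, mul_add])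
    (fun c Z W => by
      ext <;> simp [unhat_smul, B_J_left, P.J_sq] <;> ring)
    (fun Z W W' => by ext <;> simp [unhat_add, mul_add])
    (fun c Z W => by
      ext <;> simp [unhat_smul, P.J_sq] <;> ring)

theorem form10_hat (X Y : V) :
    P.form10 (P.hat X) (P.hat Y) = ⟨1 / 2 * P.B X Y, 1 / 2 * P.B X (P.J Y)⟩ := by
  simp [form10, unhat_hat]

/-- The para-complex metric on all of `V ⊗ C`, extending the one on `V^{1,0}` by
`ĝ(conj Z, conj W) = conj ĝ(Z, W)` and `ĝ(V^{1,0}, V^{0,1}) = 0`. -/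
def formC (Z W : ParaComplexification V) : ParaComplex :=
  P.form10 (P.proj10 Z) (P.proj10 W) +
    ParaComplex.conj
      (P.form10 (P.proj10 (ParaComplexification.conj V Z)) (P.proj10 (ParaComplexification.conj V W)))

theorem form10_bijective [FiniteDimensional ℝ V] :
    Function.Bijective (P.form10 : P.T10 → Module.Dual ParaComplex P.T10) := by
  constructor
  · rw [injective_iff_map_eq_zero]
    intro Z hZ
    apply P.unhat_injective
    rw [show P.unhat (0 : P.T10) = 0 by simp [unhat]]
    refine P.B_nondegenerate _ fun Y => ?_
    have h := congrArg QuadraticAlgebra.re (LinearMap.congr_fun hZ (P.hat Y))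
    rw [← P.hat_unhat Z, form10_hat] at h
    simpa using h
  · intro f
    let r : Module.Dual ℝ V :=
      { toFun := fun Y => 2 * (f (P.hat Y)).re
        map_add' := fun Y Y' => by
          simp [hat, TensorProduct.tmul_add, mul_add]
        map_smul' := fun c Y => by
          have : P.hat (c • Y) = algebraMap ℝ ParaComplex c • P.hat Y := by
            apply P.unhat_injective
            rw [unhat_smul, unhat_hat, unhat_hat]; simp
          rw [this, map_smul]; simp; ring }
    have key : ∀ Y, (f (P.hat Y)).im = (f (P.hat (P.J Y))).re := fun Y => by
      have : P.hat (P.J Y) = e • P.hat Y := by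
        apply P.unhat_injective
        rw [unhat_smul, unhat_hat, unhat_hat]; simp
      rw [this, map_smul]; simp
    refine ⟨P.hat ((P.B.toDual P.B_nondeg).symm r), LinearMap.ext fun W => ?_⟩
    rw [← P.hat_unhat W, form10_hat, LinearMap.BilinForm.apply_toDual_symm_apply,
      LinearMap.BilinForm.apply_toDual_symm_apply]
    have hr : ∀ Y, r Y = 2 * (f (P.hat Y)).re := fun _ => rfl
    ext
    · simp only [hr]; ring
    · simp only [hr, key]; ring

/-- The isomorphism `V^{1,0} ≃ (V^{1,0})^*` given by the para-complex metric. -/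
def form10Dual [FiniteDimensional ℝ V] : P.T10 ≃ₗ[ParaComplex] Module.Dual ParaComplex P.T10 :=
  LinearEquiv.ofBijective P.form10 P.form10_bijective

end ParaNordenSpace

/-! ## Curvature tensors: traces, and the classical coordinate formulas -/

section Algebra

variable {A : Type*} [CommSemiring A] {V : Type*} [AddCommMonoid V] [Module A V] {m : ℕ}

/-- The Ricci form `Ric(X, Y) = Tr {Z ↦ R(Z, X)Y}` of a tensor `R`. -/
def ricciForm (R : V →ₗ[A] V →ₗ[A] V →ₗ[A] V) : LinearMap.BilinForm A V :=
  LinearMap.mk₂ A (fun X Y => LinearMap.trace A V ((R.flip X).flip Y))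
    (fun X X' Y => by rw [← map_add]; congr 1; ext; simp)
    (fun c X Y => by rw [← map_smul]; congr 1; ext; simp)
    (fun X Y Y' => by rw [← map_add]; congr 1; ext; simp)
    (fun c X Y => by rw [← map_smul]; congr 1; ext; simp)

/-- The tensor `R` with `R(b_i, b_j) b_k = ∑ l, R^l_{k ij} b_l`; the components are given as
`comp l k i j`. -/
def tensorOfComponents (b : Module.Basis (Fin m) A V)
    (comp : Fin m → Fin m → Fin m → Fin m → A) : V →ₗ[A] V →ₗ[A] V →ₗ[A] V :=
  b.constr A fun i => b.constr A fun j => b.constr A fun k => ∑ l, comp l k i j • b l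

end Algebra

section Coordinates

variable {m : ℕ} {A : Type*} [CommRing A] [Algebra ℝ A]

/-- The partial derivative `∂_i f` of a real function on `ℝ^m`. -/
def partialReal (i : Fin m) (f : EuclideanSpace ℝ (Fin m) → ℝ) (y : EuclideanSpace ℝ (Fin m)) : ℝ :=
  fderiv ℝ f y (EuclideanSpace.single i 1)

/-- The partial derivative `∂_i f` of a para-complex valued function on `ℝ^m`. -/
def partialPara (i : Fin m) (f : EuclideanSpace ℝ (Fin m) → ParaComplex)
    (y : EuclideanSpace ℝ (Fin m)) : ParaComplex :=
  ⟨partialReal i (fun z => (f z).re) y, partialReal i (fun z => (f z).im) y⟩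

/-- The Christoffel symbols
`Γ^k_{ij} = ½ ∑ l, G^{kl} (∂_i G_{jl} + ∂_j G_{il} - ∂_l G_{ij})` of the Levi-Civita connection of
the metric with components `G_{ij} = G(∂_i, ∂_j)` (with values in `A = ℝ` or `A = C`), where `D i`
is the partial derivative of `A`-valued functions. -/
def christoffel
    (D : Fin m → (EuclideanSpace ℝ (Fin m) → A) → EuclideanSpace ℝ (Fin m) → A)
    (G : EuclideanSpace ℝ (Fin m) → Matrix (Fin m) (Fin m) A)
    (k i j : Fin m) (y : EuclideanSpace ℝ (Fin m)) : A :=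
  (1 / 2 : ℝ) • ∑ l, (G y)⁻¹ k l *
    (D i (fun z => G z j l) y + D j (fun z => G z i l) y - D l (fun z => G z i j) y)

/-- The components `R^l_{k ij}` of the curvature `R(X, Y) = [∇_X, ∇_Y] - ∇_{[X, Y]}` of the
Levi-Civita connection, `R(∂_i, ∂_j) ∂_k = ∑ l, R^l_{k ij} ∂_l`. -/
def riemannComponents
    (D : Fin m → (EuclideanSpace ℝ (Fin m) → A) → EuclideanSpace ℝ (Fin m) → A)
    (G : EuclideanSpace ℝ (Fin m) → Matrix (Fin m) (Fin m) A)
    (y : EuclideanSpace ℝ (Fin m)) (l k i j : Fin m) : A :=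
  D i (christoffel D G l j k) y - D j (christoffel D G l i k) y +
    ∑ p, (christoffel D G p j k y * christoffel D G l i p y -
      christoffel D G p i k y * christoffel D G l j p y)

end Coordinates

/-! ## Para-complex and para-Norden manifolds -/

section Manifold

variable (m : ℕ) (M : Type*) [TopologicalSpace M] [ChartedSpace (EuclideanSpace ℝ (Fin m)) M]
  [IsManifold (𝓡 m) ∞ M]

/-- A para-complex structure on a smooth manifold: a smooth field `I` of endomorphisms of the
tangent spaces, each of which is a para-complex structure, such that the two eigendistributions
`T^± M = ker (id ∓ I)` are integrable, i.e. closed under Lie brackets of local vector fields. -/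
structure ParaComplexStructure where
  I : ∀ x : M, TangentSpace (𝓡 m) x →L[ℝ] TangentSpace (𝓡 m) x
  contMDiff_I : ContMDiff (𝓡 m)
    ((𝓡 m).prod 𝓘(ℝ, EuclideanSpace ℝ (Fin m) →L[ℝ] EuclideanSpace ℝ (Fin m))) ∞
    (fun x ↦ TotalSpace.mk' (EuclideanSpace ℝ (Fin m) →L[ℝ] EuclideanSpace ℝ (Fin m))
      (E := fun x : M ↦ TangentSpace (𝓡 m) x →L[ℝ] TangentSpace (𝓡 m) x) x (I x))
  I_sq : ∀ x X, I x (I x X) = X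
  I_ne_id : ∀ x, (I x : TangentSpace (𝓡 m) x →ₗ[ℝ] TangentSpace (𝓡 m) x) ≠ LinearMap.id
  I_ne_neg_id : ∀ x, (I x : TangentSpace (𝓡 m) x →ₗ[ℝ] TangentSpace (𝓡 m) x) ≠ -LinearMap.id
  finrank_eq : ∀ x, Module.finrank ℝ (LinearMap.ker (LinearMap.id -
      (I x : TangentSpace (𝓡 m) x →ₗ[ℝ] TangentSpace (𝓡 m) x))) =
    Module.finrank ℝ (LinearMap.ker (LinearMap.id +
      (I x : TangentSpace (𝓡 m) x →ₗ[ℝ] TangentSpace (𝓡 m) x)))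
  integrable : ∀ ε : ℝ, ε = 1 ∨ ε = -1 → ∀ U : Set M, IsOpen U →
    ∀ X Y : ∀ x : M, TangentSpace (𝓡 m) x,
      ContMDiffOn (𝓡 m) (𝓡 m).tangent ∞ (fun x ↦ (X x : TangentBundle (𝓡 m) M)) U →
      ContMDiffOn (𝓡 m) (𝓡 m).tangent ∞ (fun x ↦ (Y x : TangentBundle (𝓡 m) M)) U →
      (∀ x ∈ U, I x (X x) = ε • X x) → (∀ x ∈ U, I x (Y x) = ε • Y x) →
      ∀ x ∈ U, I x (VectorField.mlieBracket (𝓡 m) X Y x) =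
        ε • VectorField.mlieBracket (𝓡 m) X Y x

variable {m M}

/-- A para-Norden metric on a para-complex manifold: a smooth symmetric non-degenerate `2`-tensor
field `g` with `g(IX, IY) = g(X, Y)`. No positivity is required. -/
structure ParaNordenMetric (S : ParaComplexStructure m M) where
  g : ∀ x : M, TangentSpace (𝓡 m) x →L[ℝ] TangentSpace (𝓡 m) x →L[ℝ] ℝ
  contMDiff_g : ContMDiff (𝓡 m)
    ((𝓡 m).prod 𝓘(ℝ, EuclideanSpace ℝ (Fin m) →L[ℝ] EuclideanSpace ℝ (Fin m) →L[ℝ] ℝ)) ∞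
    (fun x ↦ TotalSpace.mk' (EuclideanSpace ℝ (Fin m) →L[ℝ] EuclideanSpace ℝ (Fin m) →L[ℝ] ℝ)
      (E := fun x : M ↦ TangentSpace (𝓡 m) x →L[ℝ] TangentSpace (𝓡 m) x →L[ℝ] ℝ) x (g x))
  symm : ∀ x X Y, g x X Y = g x Y X
  nondegenerate : ∀ x X, (∀ Y, g x X Y = 0) → X = 0
  I_isometry : ∀ x X Y, g x (S.I x X) (S.I x Y) = g x X Y

/-- The coordinate vector `∂_i` of the chart at `c`, at the point with coordinates `y`. -/
def coordVec (c : M) (y : EuclideanSpace ℝ (Fin m)) (i : Fin m) :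
    TangentSpace (𝓡 m) ((extChartAt (𝓡 m) c).symm y) :=
  mfderiv 𝓘(ℝ, EuclideanSpace ℝ (Fin m)) (𝓡 m) (extChartAt (𝓡 m) c).symm y
    (EuclideanSpace.single i (1 : ℝ) : EuclideanSpace ℝ (Fin m))

/-- The basis of `T_x M` formed by the coordinate vectors `∂_i` of the chart at `x`. (Mathlib's
`T_x M` is the model space, the identification being the one given by this chart.) -/
def tangentBasis (x : M) : Module.Basis (Fin m) ℝ (TangentSpace (𝓡 m) x) :=
  (EuclideanSpace.basisFun (Fin m) ℝ).toBasis

namespace ParaComplexStructure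

variable (S : ParaComplexStructure m M)

/-- The components `I^k_j` of `I` in the chart at `c`, `I ∂_j = ∑ k, I^k_j ∂_k`. -/
def components (c : M) (y : EuclideanSpace ℝ (Fin m)) (k j : Fin m) : ℝ :=
  (EuclideanSpace.proj k : EuclideanSpace ℝ (Fin m) →L[ℝ] ℝ)
    (mfderiv (𝓡 m) 𝓘(ℝ, EuclideanSpace ℝ (Fin m)) (extChartAt (𝓡 m) c)
      ((extChartAt (𝓡 m) c).symm y) (S.I _ (coordVec c y j)))

end ParaComplexStructure

namespace ParaNordenMetric

variable {S : ParaComplexStructure m M} (g : ParaNordenMetric S)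

/-- The tangent space `T_x M` with `I_x` and `g_x`. -/
def tangent (x : M) : ParaNordenSpace (TangentSpace (𝓡 m) x) where
  J := S.I x
  B := LinearMap.mk₂ ℝ (fun X Y => g.g x X Y) (by simp) (by simp) (by simp) (by simp)
  J_sq := S.I_sq x
  J_ne_id := S.I_ne_id x
  J_ne_neg_id := S.I_ne_neg_id x
  finrank_eq := S.finrank_eq x
  B_symm := g.symm x
  B_nondegenerate := g.nondegenerate x
  B_J := g.I_isometry x

/-- The components `g_{ij} = g(∂_i, ∂_j)` in the chart at `c`. -/
def components (c : M) (y : EuclideanSpace ℝ (Fin m)) : Matrix (Fin m) (Fin m) ℝ :=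
  Matrix.of fun i j => g.g _ (coordVec c y i) (coordVec c y j)

/-- The components `ĝ(∂_i, ∂_j)` of the para-complex metric `ĝ` of `T_C M = TM ⊗ C` with respect to
the frame of `T_C M` formed by the coordinate vectors of the chart at `c`. -/
def hatComponents (c : M) (y : EuclideanSpace ℝ (Fin m)) : Matrix (Fin m) (Fin m) ParaComplex :=
  Matrix.of fun i j => (g.tangent ((extChartAt (𝓡 m) c).symm y)).formC
    ((1 : ParaComplex) ⊗ₜ[ℝ] coordVec c y i) ((1 : ParaComplex) ⊗ₜ[ℝ] coordVec c y j)

/-- `(M, I, g)` is para-Kähler Norden: `∇I = 0` for the Levi-Civita connection `∇` of `g`, i.e. the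
components `∂_i I^k_j + Γ^k_{il} I^l_j - Γ^l_{ij} I^k_l` of `∇I` vanish on every chart. -/
def IsParaKahler : Prop :=
  ∀ c : M, ∀ y ∈ (extChartAt (𝓡 m) c).target, ∀ i j k : Fin m,
    partialReal i (fun z => S.components c z k j) y +
      ∑ l, (christoffel partialReal (g.components c) k i l y * S.components c y l j -
        christoffel partialReal (g.components c) l i j y * S.components c y k l) = 0

/-- The Riemann curvature tensor `R` of `g` at `x`. -/
def riemann (x : M) : TangentSpace (𝓡 m) x →ₗ[ℝ] TangentSpace (𝓡 m) x →ₗ[ℝ]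
    TangentSpace (𝓡 m) x →ₗ[ℝ] TangentSpace (𝓡 m) x :=
  tensorOfComponents (tangentBasis x)
    (riemannComponents partialReal (g.components x) (extChartAt (𝓡 m) x x))

/-- The Ricci tensor `Ric(g)(X, Y) = Tr {Z ↦ R(Z, X)Y}` of `g` at `x`. -/
def ricci (x : M) : LinearMap.BilinForm ℝ (TangentSpace (𝓡 m) x) :=
  ricciForm (g.riemann x)

instance tangentFinite (x : M) : FiniteDimensional ℝ (TangentSpace (𝓡 m) x) :=
  inferInstanceAs (FiniteDimensional ℝ (EuclideanSpace ℝ (Fin m)))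

/-- The Ricci operator `Q` of `g` at `x`, `g(QX, Y) = Ric(g)(X, Y)`. -/
def ricciOp (x : M) : TangentSpace (𝓡 m) x →ₗ[ℝ] TangentSpace (𝓡 m) x :=
  ((g.tangent x).B.toDual (g.tangent x).B_nondeg).symm.toLinearMap ∘ₗ g.ricci x

/-- The real scalar curvature `K = Tr Q`. -/
def scalarCurvature (x : M) : ℝ :=
  LinearMap.trace ℝ (TangentSpace (𝓡 m) x) (g.ricciOp x)

/-- The real scalar curvature `K* = Tr (IQ)`. -/
def scalarCurvatureStar (x : M) : ℝ :=
  LinearMap.trace ℝ (TangentSpace (𝓡 m) x)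
    ((S.I x : TangentSpace (𝓡 m) x →ₗ[ℝ] TangentSpace (𝓡 m) x) ∘ₗ g.ricciOp x)

/-- The curvature tensor `R̂` at `x` of the Levi-Civita connection of `ĝ` on `T_C M`. -/
def hatRiemann (x : M) :
    ParaComplexification (TangentSpace (𝓡 m) x) →ₗ[ParaComplex]
    ParaComplexification (TangentSpace (𝓡 m) x) →ₗ[ParaComplex]
    ParaComplexification (TangentSpace (𝓡 m) x) →ₗ[ParaComplex]
    ParaComplexification (TangentSpace (𝓡 m) x) :=
  tensorOfComponents ((tangentBasis x).baseChange ParaComplex)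
    (riemannComponents partialPara (g.hatComponents x) (extChartAt (𝓡 m) x x))

/-- The fibre `T_x^{1,0} M` of the para-holomorphic tangent bundle. -/
abbrev T10 (x : M) : Submodule ParaComplex (ParaComplexification (TangentSpace (𝓡 m) x)) :=
  (g.tangent x).T10

/-- `R̂` as a tensor on `T_x^{1,0} M`: the `(1,0)`-part of `R̂(Z₁, Z₂) Z₃` for `Z_i ∈ T_x^{1,0} M`. -/
def hatRiemann10 (x : M) : g.T10 x →ₗ[ParaComplex] g.T10 x →ₗ[ParaComplex]
    g.T10 x →ₗ[ParaComplex] g.T10 x :=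
  LinearMap.mk₂ ParaComplex
    (fun Z₁ Z₂ => (g.tangent x).proj10 ∘ₗ g.hatRiemann x Z₁ Z₂ ∘ₗ (g.T10 x).subtype)
    (fun _ _ _ => by ext; simp) (fun _ _ _ => by ext; simp)
    (fun _ _ _ => by ext; simp) (fun _ _ _ => by ext; simp)

/-- The Ricci tensor `Ric(ĝ)(X̂, Ŷ) = Tr {Ẑ ↦ R̂(Ẑ, X̂)Ŷ}` on `T_x^{1,0} M`, the trace being that of a
`C`-linear endomorphism of `T_x^{1,0} M`. -/
def hatRicci (x : M) : LinearMap.BilinForm ParaComplex (g.T10 x) :=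
  ricciForm (g.hatRiemann10 x)

/-- The Ricci operator `Q̂` of `ĝ` at `x`, `ĝ(Q̂X̂, Ŷ) = Ric(ĝ)(X̂, Ŷ)`. -/
def hatRicciOp (x : M) : g.T10 x →ₗ[ParaComplex] g.T10 x :=
  (g.tangent x).form10Dual.symm.toLinearMap ∘ₗ g.hatRicci x

/-- The para-holomorphic scalar curvature `K̂ = Tr Q̂` of `ĝ`. -/
def hatScalarCurvature (x : M) : ParaComplex :=
  LinearMap.trace ParaComplex (g.T10 x) (g.hatRicciOp x)

end ParaNordenMetric

end Manifold

end

/-! A real vector X is the sum of X̂ and its conjugate, so ĝ(X, Y) = g(X, Y) on real vectors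
(`formC_one_tmul`). In a coordinate frame ĝ therefore has the same components as g. The Christoffel
symbols and the curvature arise from them by operations that commute with ℝ → C, so R̂ is the
C-trilinear extension of R (`hatRiemann_one_tmul`).

The condition ∇I = 0 makes each R(X, Y) commute with I. Pair symmetry and the Bianchi identity carry
I to the other slots: R(IX, Y)Z = R(X, IY)Z = I R(X, Y)Z (`map_J_left`, `map_J_right`). Since X̂ =
½(1 + eI)X, it follows that R̂(X̂, Ŷ)Ẑ is the hat of R(X, Y)Z (`extension_hat`).

The rest is linear algebra. The real isomorphism X ↦ X̂ turns I into multiplication by e, and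
V^{1,0} is free over C because the eigenspaces of I have equal dimension. If a C-linear A
corresponds to T under it, then Tr T = 2 Re Tr A; the same for eA gives Tr A = ½(Tr T + e Tr(IT))
(`trace_T10`). For Z ↦ R(Z, X)Y this reads Ric(ĝ)(X̂, Ŷ) = ½(Ric(X, Y) + e Ric(X, IY)), which has
the shape of ĝ, so Q̂ corresponds to Q. For A = Q̂ it is the claim. -/

noncomputable section

/-! ### Traces over the para-complex numbers and the real model of V^{1,0} -/

theorem LinearMap.trace_restrictScalars_paraComplex {W ι : Type*} [AddCommMonoid W]
    [Module ParaComplex W] [Module ℝ W] [IsScalarTower ℝ ParaComplex W] [Fintype ι] [DecidableEq ι]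
    (b : Module.Basis ι ParaComplex W) (A : W →ₗ[ParaComplex] W) :
    LinearMap.trace ℝ W (A.restrictScalars ℝ) = 2 * (LinearMap.trace ParaComplex W A).re := by
  rw [LinearMap.trace_eq_matrix_trace ParaComplex b,
    LinearMap.trace_eq_matrix_trace ℝ ((QuadraticAlgebra.basis (R := ℝ) 1 0).smulTower b)]
  have hre : ∀ s : Finset ι, ∀ f : ι → ParaComplex, (∑ i ∈ s, f i).re = ∑ i ∈ s, (f i).re :=
    fun s f => map_sum ParaComplex.reL f s
  rw [Matrix.trace, Matrix.trace, hre, Fintype.sum_prod_type_right, Finset.mul_sum]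
  -- In the real basis (1, e), multiplication by a + eb has both diagonal entries equal to a, so
  -- each diagonal entry of A contributes twice its real part.
  refine Finset.sum_congr rfl fun i _ => ?_
  have h1 : QuadraticAlgebra.basis (R := ℝ) 1 0 0 = 1 := by
    apply (QuadraticAlgebra.basis (R := ℝ) 1 0).repr.injective
    rw [Module.Basis.repr_self]
    apply DFunLike.coe_injective
    rw [QuadraticAlgebra.basis_repr_apply]
    ext j; fin_cases j <;> simp [QuadraticAlgebra.re_one, QuadraticAlgebra.im_one]
  have h2 : QuadraticAlgebra.basis (R := ℝ) 1 0 1 = ParaComplex.e := by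
    apply (QuadraticAlgebra.basis (R := ℝ) 1 0).repr.injective
    rw [Module.Basis.repr_self]
    apply DFunLike.coe_injective
    rw [QuadraticAlgebra.basis_repr_apply]
    ext j; fin_cases j <;> simp
  simp [LinearMap.toMatrix_apply, Module.Basis.smulTower_repr, Fin.sum_univ_two, h1, h2,
    QuadraticAlgebra.basis_repr_apply, two_mul, QuadraticAlgebra.re_one,
    QuadraticAlgebra.im_one]

namespace ParaNordenSpace

open ParaComplex ParaComplexification

variable {V : Type*} [AddCommGroup V] [Module ℝ V] (P : ParaNordenSpace V)

theorem hat_add (X Y : V) : P.hat (X + Y) = P.hat X + P.hat Y := by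
  simp [hat, TensorProduct.tmul_add]

theorem hat_smul (c : ℝ) (X : V) : P.hat (c • X) = c • P.hat X := by
  rw [hat, hat, TensorProduct.tmul_smul, LinearMap.map_smul_of_tower]

theorem hat_J (X : V) : P.hat (P.J X) = e • P.hat X := by
  apply P.unhat_injective
  rw [unhat_smul, unhat_hat, unhat_hat]
  simp

theorem smul_hat (c : ParaComplex) (X : V) : c • P.hat X = P.hat (c.re • X + c.im • P.J X) := by
  apply P.unhat_injective
  rw [unhat_smul, unhat_hat, unhat_hat]

/-- The real-linear isomorphism `X ↦ X̂`. -/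
def hatEquiv : V ≃ₗ[ℝ] P.T10 where
  toFun := P.hat
  map_add' := P.hat_add
  map_smul' := P.hat_smul
  invFun := P.unhat
  left_inv := P.unhat_hat
  right_inv := P.hat_unhat

theorem isCompl_ker : IsCompl (LinearMap.ker (LinearMap.id - P.J))
    (LinearMap.ker (LinearMap.id + P.J)) := by
  constructor
  · rw [Submodule.disjoint_def]
    intro X h1 h2
    simp only [LinearMap.mem_ker, LinearMap.sub_apply, LinearMap.add_apply,
      LinearMap.id_apply] at h1 h2
    have : (2 : ℝ) • X = 0 := by
      rw [two_smul, ← add_zero (0 : V)]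
      nth_rw 1 [← h1]
      rw [← h2]
      abel
    simpa using this
  · rw [codisjoint_iff, eq_top_iff]
    intro X _
    rw [Submodule.mem_sup]
    refine ⟨(1 / 2 : ℝ) • (X + P.J X), ?_, (1 / 2 : ℝ) • (X - P.J X), ?_, ?_⟩
    · simp [P.J_sq, add_comm]
    · simp [P.J_sq]
    · rw [← smul_add, add_add_sub_cancel, ← two_smul ℝ, smul_smul]; simp

/-- `V^{1,0}` is free over `C`, since the eigenspaces of `J` have the same dimension. -/
theorem exists_basis_T10 [FiniteDimensional ℝ V] :
    ∃ n : ℕ, Nonempty (Module.Basis (Fin n) ParaComplex P.T10) := by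
  set n := Module.finrank ℝ (LinearMap.ker (LinearMap.id - P.J)) with hn
  let u := Module.finBasisOfFinrankEq ℝ (LinearMap.ker (LinearMap.id - P.J)) hn.symm
  let v := Module.finBasisOfFinrankEq ℝ (LinearMap.ker (LinearMap.id + P.J))
    (P.finrank_eq.symm.trans hn.symm)
  let w : Module.Basis (Fin n ⊕ Fin n) ℝ V :=
    (u.prod v).map (Submodule.prodEquivOfIsCompl _ _ P.isCompl_ker)
  have wl : ∀ i, w (Sum.inl i) = u i := fun i => by simp [w]
  have wr : ∀ i, w (Sum.inr i) = v i := fun i => by simp [w]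
  have Ju : ∀ i, P.J (w (Sum.inl i)) = w (Sum.inl i) := fun i => by
    have := LinearMap.mem_ker.1 (u i).2
    rw [LinearMap.sub_apply, sub_eq_zero] at this
    rw [wl]
    exact this.symm
  have Jv : ∀ i, P.J (w (Sum.inr i)) = -w (Sum.inr i) := fun i => by
    have := LinearMap.mem_ker.1 (v i).2
    rw [LinearMap.add_apply, add_eq_zero_iff_eq_neg'] at this
    rw [wr]
    exact this
  -- As e acts through J, (a + eb) times this vector is the hat of (a + b)u_i + (a - b)v_i. A single
  -- û_i would not do: (1 - e)û_i = 0. The pairing of u with v is where equal ranks enter.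
  let f : Fin n → P.T10 := fun i => P.hat (w (Sum.inl i) + w (Sum.inr i))
  have hcomb : ∀ c : Fin n → ParaComplex, ∑ i, c i • f i = P.hatEquiv
      (∑ i, ((c i).re + (c i).im) • w (Sum.inl i) + ∑ i, ((c i).re - (c i).im) • w (Sum.inr i)) := by
    intro c
    rw [← Finset.sum_add_distrib, map_sum]
    refine Finset.sum_congr rfl fun i _ => ?_
    rw [P.smul_hat]
    change _ = P.hat _
    rw [map_add, Ju, Jv]
    congr 1
    module
  refine ⟨n, ⟨Module.Basis.mk (v := f) ?_ ?_⟩⟩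
  · rw [Fintype.linearIndependent_iffₛ]
    intro c d hcd i
    rw [hcomb, hcomb, P.hatEquiv.injective.eq_iff] at hcd
    have h1 := congrArg (fun X => w.repr X (Sum.inl i)) hcd
    have h2 := congrArg (fun X => w.repr X (Sum.inr i)) hcd
    simp [Finsupp.single_apply, Finset.sum_add_distrib] at h1 h2
    ext <;> linarith
  · intro Z _
    -- The coefficient a + eb solves a + b = α, a - b = β, where α and β are the coordinates along
    -- u_i and v_i.
    have hZ : Z = ∑ i, (⟨(w.repr (P.unhat Z) (Sum.inl i) + w.repr (P.unhat Z) (Sum.inr i)) / 2,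
        (w.repr (P.unhat Z) (Sum.inl i) - w.repr (P.unhat Z) (Sum.inr i)) / 2⟩ : ParaComplex)
          • f i := by
      rw [hcomb]
      conv_lhs => rw [← P.hat_unhat Z, ← w.sum_repr (P.unhat Z), Fintype.sum_sum_type]
      change P.hatEquiv _ = _
      congr 3 <;> · ext i; congr 1; ring
    rw [hZ]
    exact Submodule.sum_mem _ fun i _ => Submodule.smul_mem _ _ (Submodule.subset_span ⟨i, rfl⟩)

/-- The trace over `C` of an endomorphism of `V^{1,0}`, in terms of the endomorphism of `V`
that corresponds to it. -/
theorem trace_T10 [FiniteDimensional ℝ V] (A : P.T10 →ₗ[ParaComplex] P.T10) (T : V →ₗ[ℝ] V)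
    (h : ∀ X, A (P.hat X) = P.hat (T X)) :
    LinearMap.trace ParaComplex P.T10 A =
      ⟨1 / 2 * LinearMap.trace ℝ V T, 1 / 2 * LinearMap.trace ℝ V (P.J ∘ₗ T)⟩ := by
  obtain ⟨n, ⟨b⟩⟩ := P.exists_basis_T10
  have key : ∀ (A : P.T10 →ₗ[ParaComplex] P.T10) (T : V →ₗ[ℝ] V),
      (∀ X, A (P.hat X) = P.hat (T X)) →
      2 * (LinearMap.trace ParaComplex P.T10 A).re = LinearMap.trace ℝ V T := by
    intro A T h
    rw [← LinearMap.trace_restrictScalars_paraComplex b, ← LinearMap.trace_conj' (N := P.T10) T P.hatEquiv]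
    congr 1
    ext1 Z
    rw [LinearEquiv.conj_apply_apply]
    change A Z = P.hat (T (P.unhat Z))
    rw [← h, P.hat_unhat]
  have h1 := key A T h
  -- The imaginary part of Tr A is the real part of e Tr A = Tr(eA), and eA corresponds to J ∘ T.
  have h2 := key (e • A) (P.J ∘ₗ T) fun X => by
    rw [LinearMap.smul_apply, h, LinearMap.comp_apply, P.hat_J]
  rw [map_smul] at h2
  ext
  · simp only; linarith
  · simp only [smul_eq_mul, QuadraticAlgebra.re_mul, QuadraticAlgebra.omega_re,
      QuadraticAlgebra.omega_im] at h2 ⊢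
    linarith

/-- The (1,0)-part and the (0,1)-part contribute conjugate values, whose sum is twice the real part
½ g(X, Y). Hence ĝ is the C-bilinear extension of g. -/
theorem formC_one_tmul (X Y : V) :
    P.formC ((1 : ParaComplex) ⊗ₜ[ℝ] X) ((1 : ParaComplex) ⊗ₜ[ℝ] Y) =
      algebraMap ℝ ParaComplex (P.B X Y) := by
  have h1 : ∀ X : V, ParaComplexification.conj V ((1 : ParaComplex) ⊗ₜ[ℝ] X) = 1 ⊗ₜ[ℝ] X := by
    intro X
    have : ParaComplex.conj 1 = 1 := by ext <;> simp [ParaComplex.conj, QuadraticAlgebra.im_one]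
    rw [ParaComplexification.conj, LinearMap.rTensor_tmul, this]
  rw [formC, h1, h1]
  change P.form10 (P.hat X) (P.hat Y) + ParaComplex.conj (P.form10 (P.hat X) (P.hat Y)) = _
  rw [form10_hat]
  ext
  · simp [ParaComplex.conj]; ring
  · simp [ParaComplex.conj]

end ParaNordenSpace

/-! ### Algebra of para-Kähler curvature tensors -/

namespace ParaNordenSpace

open ParaComplex ParaComplexification

variable {V : Type*} [AddCommGroup V] [Module ℝ V] (P : ParaNordenSpace V)

/-- The algebraic properties of the curvature tensor of a para-Kähler Norden manifold. -/
structure IsParaKahlerCurvature (R : V →ₗ[ℝ] V →ₗ[ℝ] V →ₗ[ℝ] V) : Prop where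
  antisymm : ∀ X Y Z, R X Y Z = -R Y X Z
  skew : ∀ X Y Z W, P.B (R X Y Z) W = -P.B (R X Y W) Z
  bianchi : ∀ X Y Z, R X Y Z + R Y Z X + R Z X Y = 0
  map_J : ∀ X Y Z, R X Y (P.J Z) = P.J (R X Y Z)

namespace IsParaKahlerCurvature

variable {P} {R : V →ₗ[ℝ] V →ₗ[ℝ] V →ₗ[ℝ] V} (hR : P.IsParaKahlerCurvature R)
include hR

theorem pair_symm (X Y Z W : V) : P.B (R X Y Z) W = P.B (R Z W X) Y := by
  have b : ∀ X Y Z W, P.B (R X Y Z) W + P.B (R Y Z X) W + P.B (R Z X Y) W = 0 := by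
    intro X Y Z W
    rw [← LinearMap.add_apply, ← LinearMap.add_apply, ← map_add, ← map_add, hR.bianchi]
    simp
  have a : ∀ X Y Z W, P.B (R X Y Z) W = -P.B (R Y X Z) W := by
    intro X Y Z W
    rw [hR.antisymm]; simp
  have s := hR.skew
  -- The classical octahedron argument: four Bianchi identities are combined, and the two
  -- antisymmetries cancel all but the wanted terms.
  linarith [b X Y Z W, b Y Z W X, b Z W X Y, b W X Y Z, a X Y Z W, a X Y W Z, a Y Z X W, a Y Z W X,
    a Z X Y W, a Z X W Y, a Z W X Y, a Z W Y X, a W Y Z X, a W Y X Z, a X W Y Z, a X W Z Y,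
    s X Y Z W, s Y Z X W, s Z X Y W, s Z W X Y, s W Y Z X, s X W Y Z, s Y X Z W, s Z Y X W,
    s X Z Y W, s W Z X Y, s Y W Z X, s W X Y Z]

/-- Pair symmetry moves J into the third argument of R, where it commutes with R(Z, W);
self-adjointness of J for the metric then passes it to the other vector. -/
theorem J_left_eq_J_right (X Y Z : V) : R (P.J X) Y Z = R X (P.J Y) Z := by
  rw [← sub_eq_zero]
  refine P.B_nondegenerate _ fun W => ?_
  rw [map_sub, LinearMap.sub_apply, hR.pair_symm, hR.pair_symm X, hR.map_J, P.B_J_left, sub_self]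

/-- Let D(X, Y, Z) be the difference of the two sides. Subtracting J of the Bianchi identity for (X,
Y, Z) from the one for (JX, Y, Z) leaves D(X, Y, Z) = -D(Z, X, Y). Three cyclic shifts return to the
start with sign -1, so D = 0. -/
theorem map_J_left (X Y Z : V) : R (P.J X) Y Z = P.J (R X Y Z) := by
  have key : ∀ X Y Z, R (P.J X) Y Z - P.J (R X Y Z) = -(R (P.J Z) X Y - P.J (R Z X Y)) := by
    intro X Y Z
    have h1 := hR.bianchi (P.J X) Y Z
    have h2 := congrArg P.J (hR.bianchi X Y Z)
    rw [hR.map_J, ← hR.J_left_eq_J_right] at h1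
    simp only [map_add, map_zero] at h2
    have h3 := h1.trans h2.symm
    rw [← sub_eq_zero] at h3 ⊢
    rw [← h3]
    abel
  have h := key X Y Z
  rw [key Z X Y, key Y Z X, neg_neg] at h
  have h2 : (2 : ℝ) • (R (P.J X) Y Z - P.J (R X Y Z)) = 0 := by
    rw [two_smul]; nth_rw 1 [h]; exact neg_add_cancel _
  rw [smul_eq_zero] at h2
  exact sub_eq_zero.1 (h2.resolve_left two_ne_zero)

theorem map_J_right (X Y Z : V) : R X (P.J Y) Z = P.J (R X Y Z) := by
  rw [← hR.J_left_eq_J_right, hR.map_J_left]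

end IsParaKahlerCurvature

theorem coe_hat (X : V) : (P.hat X : ParaComplexification V) = algebraMap ℝ ParaComplex (1 / 2) •
    ((1 : ParaComplex) ⊗ₜ[ℝ] X + e • ((1 : ParaComplex) ⊗ₜ[ℝ] P.J X)) := rfl

/-- This holds because J becomes e under the hat and e² = 1. It absorbs the repeated factors ½(1 +
eJ) when several arguments carry hats. -/
theorem half_smul_coe_hat_add (X : V) : algebraMap ℝ ParaComplex (1 / 2) •
    ((P.hat X : ParaComplexification V) + e • (P.hat (P.J X) : ParaComplexification V)) =
      P.hat X := by
  rw [P.hat_J, Submodule.coe_smul, smul_smul, e_mul_e, one_smul, ← two_smul ParaComplex, smul_smul]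
  have : algebraMap ℝ ParaComplex (1 / 2) * 2 = 1 := by
    rw [← map_ofNat (algebraMap ℝ ParaComplex) 2, ← map_mul]; simp
  rw [this, one_smul]

theorem proj10_coe (Z : P.T10) : P.proj10 (Z : ParaComplexification V) = Z := by
  conv_rhs => rw [← P.hat_unhat Z]
  conv_lhs => rw [← P.hat_unhat Z]
  apply Subtype.ext
  refine Eq.trans ?_ (P.half_smul_coe_hat_add _)
  rw [P.coe_hat]
  have : ∀ Y : V, (P.proj10 ((1 : ParaComplex) ⊗ₜ[ℝ] Y) : ParaComplexification V) = P.hat Y :=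
    fun _ => rfl
  simp only [map_smul, map_add, Submodule.coe_smul, Submodule.coe_add, this]
  rw [← P.coe_hat (P.unhat Z)]

variable {R : V →ₗ[ℝ] V →ₗ[ℝ] V →ₗ[ℝ] V}
  {RC : ParaComplexification V →ₗ[ParaComplex] ParaComplexification V →ₗ[ParaComplex]
    ParaComplexification V →ₗ[ParaComplex] ParaComplexification V}

/-- Only the last slot matters: R(X, Y) commutes with J, so its extension commutes with the
extension of J and preserves the e-eigenspace. -/
theorem extension_mem_T10 (hR : P.IsParaKahlerCurvature R)
    (hRC : ∀ X Y Z, RC (1 ⊗ₜ[ℝ] X) (1 ⊗ₜ[ℝ] Y) (1 ⊗ₜ[ℝ] Z) = 1 ⊗ₜ[ℝ] R X Y Z)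
    (Z₁ Z₂ Z₃ : ParaComplexification V) (h : Z₃ ∈ P.T10) : RC Z₁ Z₂ Z₃ ∈ P.T10 := by
  rw [mem_T10] at h ⊢
  rw [← map_smul, ← h]
  -- With e • Z₃ replaced by the image of Z₃ under J, the goal is an identity valid for every Z₃,
  -- open to induction on tensors.
  clear h
  have ht : ∀ (a : ParaComplex) (X : V), a ⊗ₜ[ℝ] X = a • ((1 : ParaComplex) ⊗ₜ[ℝ] X) := by
    intro a X; rw [TensorProduct.smul_tmul', smul_eq_mul, mul_one]
  induction Z₁ using TensorProduct.induction_on with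
  | zero => simp
  | add Z W hZ hW => simp only [map_add, LinearMap.add_apply, hZ, hW]
  | tmul a X =>
  induction Z₂ using TensorProduct.induction_on with
  | zero => simp
  | add Z W hZ hW => simp only [map_add, LinearMap.add_apply, hZ, hW]
  | tmul b Y =>
  induction Z₃ using TensorProduct.induction_on with
  | zero => simp
  | add Z W hZ hW => simp only [map_add, hZ, hW]
  | tmul c Z =>
  have hJ : ∀ X : V, P.JC ((1 : ParaComplex) ⊗ₜ[ℝ] X) = 1 ⊗ₜ[ℝ] P.J X := fun X => rfl
  rw [ht a, ht b, ht c]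
  simp only [map_smul, LinearMap.smul_apply, hRC, hJ, hR.map_J]

/-- Hats are inserted slot by slot. The first one produces the projection ½(1 + eJ) of R(X, Y)Z; the
next two project again, without effect. -/
theorem extension_hat (hR : P.IsParaKahlerCurvature R)
    (hRC : ∀ X Y Z, RC (1 ⊗ₜ[ℝ] X) (1 ⊗ₜ[ℝ] Y) (1 ⊗ₜ[ℝ] Z) = 1 ⊗ₜ[ℝ] R X Y Z) (X Y Z : V) :
    RC (P.hat X) (P.hat Y) (P.hat Z) = P.hat (R X Y Z) := by
  have h1 : ∀ X Y Z, RC (P.hat X) (1 ⊗ₜ[ℝ] Y) (1 ⊗ₜ[ℝ] Z) = P.hat (R X Y Z) := by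
    intro X Y Z
    rw [P.coe_hat, P.coe_hat]
    simp only [map_smul, map_add, LinearMap.smul_apply, LinearMap.add_apply, hRC, hR.map_J_left]
  have h2 : ∀ X Y Z, RC (P.hat X) (P.hat Y) (1 ⊗ₜ[ℝ] Z) = P.hat (R X Y Z) := by
    intro X Y Z
    refine Eq.trans ?_ (P.half_smul_coe_hat_add _)
    rw [P.coe_hat Y]
    simp only [map_smul, map_add, LinearMap.smul_apply, LinearMap.add_apply, h1, hR.map_J_right]
  refine Eq.trans ?_ (P.half_smul_coe_hat_add _)
  rw [P.coe_hat Z]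
  simp only [map_smul, map_add, h2, hR.map_J]

variable [FiniteDimensional ℝ V]
  {R10 : P.T10 →ₗ[ParaComplex] P.T10 →ₗ[ParaComplex] P.T10 →ₗ[ParaComplex] P.T10}

/-- This is `trace_T10` for Z ↦ R(Z, X)Y; composing with J replaces Y by JY. -/
theorem ricciForm_hat (hR : P.IsParaKahlerCurvature R)
    (h10 : ∀ X Y Z, R10 (P.hat X) (P.hat Y) (P.hat Z) = P.hat (R X Y Z)) (X Y : V) :
    ricciForm R10 (P.hat X) (P.hat Y) =
      ⟨1 / 2 * ricciForm R X Y, 1 / 2 * ricciForm R X (P.J Y)⟩ := by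
  have h : (P.J ∘ₗ (R.flip X).flip Y) = (R.flip X).flip (P.J Y) := by
    ext Z
    simp [hR.map_J]
  have := P.trace_T10 ((R10.flip (P.hat X)).flip (P.hat Y)) ((R.flip X).flip Y)
    fun Z => by simp [h10]
  rw [h] at this
  exact this

/-- The scalar curvature of a para-Kähler curvature tensor, computed on `V` and on `V^{1,0}`. -/
theorem trace_ricciOp (hR : P.IsParaKahlerCurvature R)
    (h10 : ∀ X Y Z, R10 (P.hat X) (P.hat Y) (P.hat Z) = P.hat (R X Y Z)) :
    LinearMap.trace ParaComplex P.T10 (P.form10Dual.symm.toLinearMap ∘ₗ ricciForm R10) =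
      ⟨1 / 2 * LinearMap.trace ℝ V ((P.B.toDual P.B_nondeg).symm.toLinearMap ∘ₗ ricciForm R),
        1 / 2 * LinearMap.trace ℝ V
          (P.J ∘ₗ (P.B.toDual P.B_nondeg).symm.toLinearMap ∘ₗ ricciForm R)⟩ := by
  refine P.trace_T10 _ _ fun X => ?_
  rw [LinearMap.comp_apply, LinearEquiv.coe_coe, LinearEquiv.symm_apply_eq]
  refine LinearMap.ext fun W => ?_
  rw [← P.hat_unhat W, P.ricciForm_hat hR h10]
  change _ = P.form10 _ _
  rw [P.form10_hat]
  simp only [LinearMap.comp_apply, LinearEquiv.coe_coe,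
    LinearMap.BilinForm.apply_toDual_symm_apply]

end ParaNordenSpace

/-! ### Rules for coordinate partial derivatives -/

section PartialDerivatives

variable {m : ℕ} {f h : EuclideanSpace ℝ (Fin m) → ℝ} {y : EuclideanSpace ℝ (Fin m)}

theorem partialReal_add (i : Fin m) (hf : DifferentiableAt ℝ f y) (hh : DifferentiableAt ℝ h y) :
    partialReal i (fun z => f z + h z) y = partialReal i f y + partialReal i h y := by
  simp [partialReal, fderiv_fun_add hf hh]

theorem partialReal_sum {ι : Type*} (s : Finset ι) {f : ι → EuclideanSpace ℝ (Fin m) → ℝ}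
    (i : Fin m) (hf : ∀ a ∈ s, DifferentiableAt ℝ (f a) y) :
    partialReal i (fun z => ∑ a ∈ s, f a z) y = ∑ a ∈ s, partialReal i (f a) y := by
  simp [partialReal, fderiv_fun_sum hf]

theorem partialReal_mul (i : Fin m) (hf : DifferentiableAt ℝ f y) (hh : DifferentiableAt ℝ h y) :
    partialReal i (fun z => f z * h z) y = partialReal i f y * h y + f y * partialReal i h y := by
  simp [partialReal, fderiv_fun_mul hf hh]
  ring

theorem partialReal_neg (i : Fin m) :
    partialReal i (fun z => -f z) y = -partialReal i f y := by
  simp [partialReal]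

theorem Filter.EventuallyEq.partialReal_eq (i : Fin m) (hfh : f =ᶠ[nhds y] h) :
    partialReal i f y = partialReal i h y := by
  simp [partialReal, hfh.fderiv_eq]

theorem ContDiffAt.partialReal (i : Fin m) (hf : ContDiffAt ℝ ∞ f y) :
    ContDiffAt ℝ ∞ (partialReal i f) y :=
  (hf.fderiv_right (m := ∞) (by simp)).clm_apply contDiffAt_const

theorem partialReal_comm (i j : Fin m) (hf : ContDiffAt ℝ ∞ f y) :
    partialReal i (partialReal j f) y = partialReal j (partialReal i f) y := by
  have hd : DifferentiableAt ℝ (fderiv ℝ f) y :=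
    (hf.fderiv_right (m := ∞) (by simp)).differentiableAt (by simp)
  have hs := hf.isSymmSndFDerivAt
    (by rw [minSmoothness_of_isRCLikeNormedField]; exact WithTop.coe_le_coe.2 (le_top : (2 : ℕ∞) ≤ ⊤))
    (EuclideanSpace.single i 1) (EuclideanSpace.single j 1)
  have key : ∀ i j : Fin m, partialReal i (partialReal j f) y =
      fderiv ℝ (fderiv ℝ f) y (EuclideanSpace.single i 1) (EuclideanSpace.single j 1) := by
    intro i j
    unfold partialReal
    rw [fderiv_clm_apply hd (by simp)]
    simp
  rw [key, key, hs]

theorem partialPara_algebraMap (i : Fin m) :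
    partialPara i (fun z => algebraMap ℝ ParaComplex (f z)) y =
      algebraMap ℝ ParaComplex (partialReal i f y) := by
  ext <;> simp [partialPara, partialReal]

end PartialDerivatives

/-! ### Calculus of matrix-valued functions -/

section MatrixCalculus

variable {m : ℕ} {y : EuclideanSpace ℝ (Fin m)}
  {F H : EuclideanSpace ℝ (Fin m) → Matrix (Fin m) (Fin m) ℝ}

/-- The entrywise partial derivative of a matrix valued function. -/
def partialMatrix (i : Fin m) (F : EuclideanSpace ℝ (Fin m) → Matrix (Fin m) (Fin m) ℝ)
    (y : EuclideanSpace ℝ (Fin m)) : Matrix (Fin m) (Fin m) ℝ :=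
  Matrix.of fun a b => partialReal i (fun z => F z a b) y

/-- Smoothness at a point of all the entries of a matrix valued function. -/
def SmoothEntriesAt (F : EuclideanSpace ℝ (Fin m) → Matrix (Fin m) (Fin m) ℝ)
    (y : EuclideanSpace ℝ (Fin m)) : Prop :=
  ∀ a b, ContDiffAt ℝ ∞ (fun z => F z a b) y

theorem SmoothEntriesAt.differentiableAt (hF : SmoothEntriesAt F y) (a b : Fin m) :
    DifferentiableAt ℝ (fun z => F z a b) y :=
  (hF a b).differentiableAt (by simp)

theorem SmoothEntriesAt.mul (hF : SmoothEntriesAt F y) (hH : SmoothEntriesAt H y) :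
    SmoothEntriesAt (fun z => F z * H z) y := fun a b => by
  simp only [Matrix.mul_apply]
  exact ContDiffAt.sum fun k _ => (hF a k).mul (hH k b)

theorem SmoothEntriesAt.neg (hF : SmoothEntriesAt F y) :
    SmoothEntriesAt (fun z => -F z) y := fun a b => (hF a b).neg

theorem SmoothEntriesAt.transpose (hF : SmoothEntriesAt F y) :
    SmoothEntriesAt (fun z => (F z).transpose) y := fun a b => hF b a

theorem SmoothEntriesAt.det (hF : SmoothEntriesAt F y) :
    ContDiffAt ℝ ∞ (fun z => (F z).det) y := by
  simp only [Matrix.det_apply]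
  refine ContDiffAt.sum fun σ _ => ContDiffAt.const_smul _ ?_
  exact contDiffAt_prod fun k _ => hF _ _

theorem SmoothEntriesAt.inv (hF : SmoothEntriesAt F y) (hdet : (F y).det ≠ 0) :
    SmoothEntriesAt (fun z => (F z)⁻¹) y := fun a b => by
  simp only [Matrix.inv_def, Ring.inverse_eq_inv', Matrix.smul_apply, smul_eq_mul,
    Matrix.adjugate_apply]
  refine (hF.det.inv hdet).mul (SmoothEntriesAt.det fun k l => ?_)
  simp only [Matrix.updateRow_apply]
  split_ifs
  · exact contDiffAt_const
  · exact hF k l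

theorem partialMatrix_add (i : Fin m) (hF : SmoothEntriesAt F y) (hH : SmoothEntriesAt H y) :
    partialMatrix i (fun z => F z + H z) y = partialMatrix i F y + partialMatrix i H y := by
  ext a b
  exact partialReal_add i (hF.differentiableAt a b) (hH.differentiableAt a b)

theorem partialMatrix_neg (i : Fin m) :
    partialMatrix i (fun z => -F z) y = -partialMatrix i F y := by
  ext a b
  exact partialReal_neg i

theorem partialMatrix_mul (i : Fin m) (hF : SmoothEntriesAt F y) (hH : SmoothEntriesAt H y) :
    partialMatrix i (fun z => F z * H z) y =
      partialMatrix i F y * H y + F y * partialMatrix i H y := by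
  ext a b
  simp only [partialMatrix, Matrix.of_apply, Matrix.add_apply, Matrix.mul_apply]
  rw [partialReal_sum (f := fun k z => F z a k * H z k b) _ _ fun k _ => (hF.differentiableAt a k).mul (hH.differentiableAt k b),
    ← Finset.sum_add_distrib]
  exact Finset.sum_congr rfl fun k _ =>
    partialReal_mul i (hF.differentiableAt a k) (hH.differentiableAt k b)

theorem Filter.EventuallyEq.partialMatrix_eq (i : Fin m) (hFH : F =ᶠ[nhds y] H) :
    partialMatrix i F y = partialMatrix i H y := by
  ext a b
  exact Filter.EventuallyEq.partialReal_eq i (hFH.mono fun z hz => congrFun (congrFun hz a) b)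

theorem partialMatrix_comm (i j : Fin m) (hF : SmoothEntriesAt F y) :
    partialMatrix i (partialMatrix j F) y = partialMatrix j (partialMatrix i F) y := by
  ext a b
  exact partialReal_comm i j (hF a b)

/-- The Ricci identity for a matrix valued function `F` with `∂_i F = A_i F + F B_i`. -/
theorem partialMatrix_integrability
    {A B : Fin m → EuclideanSpace ℝ (Fin m) → Matrix (Fin m) (Fin m) ℝ}
    (hF : SmoothEntriesAt F y) (hA : ∀ i, SmoothEntriesAt (A i) y)
    (hB : ∀ i, SmoothEntriesAt (B i) y)
    (h : ∀ i, ∀ᶠ z in nhds y, partialMatrix i F z = A i z * F z + F z * B i z) (i j : Fin m) :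
    (partialMatrix i (A j) y - partialMatrix j (A i) y + A j y * A i y - A i y * A j y) * F y +
      F y * (partialMatrix i (B j) y - partialMatrix j (B i) y + B i y * B j y - B j y * B i y)
        = 0 := by
  have key : ∀ i j, partialMatrix i (partialMatrix j F) y =
      partialMatrix i (A j) y * F y + A j y * (A i y * F y + F y * B i y) +
        ((A i y * F y + F y * B i y) * B j y + F y * partialMatrix i (B j) y) := by
    intro i j
    rw [Filter.EventuallyEq.partialMatrix_eq i (h j),
      partialMatrix_add i ((hA j).mul hF) (hF.mul (hB j)), partialMatrix_mul i (hA j) hF,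
      partialMatrix_mul i hF (hB j), (h i).self_of_nhds]
  -- Second derivatives commute; in the difference of the two expansions the mixed terms A F B
  -- cancel.
  have h2 := partialMatrix_comm i j hF
  rw [key, key, ← sub_eq_zero] at h2
  rw [← h2]
  noncomm_ring

end MatrixCalculus

/-! ### Levi-Civita connection and curvature in coordinates -/

section LeviCivita

variable {m : ℕ} {y : EuclideanSpace ℝ (Fin m)}
  {G : EuclideanSpace ℝ (Fin m) → Matrix (Fin m) (Fin m) ℝ}

/-- The connection matrix `Γ_i` of the Levi-Civita connection, `(Γ_i)^k_j = Γ^k_{ij}`. -/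
def connectionMatrix (G : EuclideanSpace ℝ (Fin m) → Matrix (Fin m) (Fin m) ℝ) (i : Fin m)
    (y : EuclideanSpace ℝ (Fin m)) : Matrix (Fin m) (Fin m) ℝ :=
  Matrix.of fun k j => christoffel partialReal G k i j y

/-- The curvature matrix `(R_{ij})^l_k = R^l_{k ij}`. -/
def curvatureMatrix (G : EuclideanSpace ℝ (Fin m) → Matrix (Fin m) (Fin m) ℝ)
    (y : EuclideanSpace ℝ (Fin m)) (i j : Fin m) : Matrix (Fin m) (Fin m) ℝ :=
  Matrix.of fun l k => riemannComponents partialReal G y l k i j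

/-- The form ∂_iΓ_j - ∂_jΓ_i + [Γ_i, Γ_j] is the one that `partialMatrix_integrability` produces. -/
theorem curvatureMatrix_eq (i j : Fin m) : curvatureMatrix G y i j =
    partialMatrix i (connectionMatrix G j) y - partialMatrix j (connectionMatrix G i) y +
      connectionMatrix G i y * connectionMatrix G j y -
      connectionMatrix G j y * connectionMatrix G i y := by
  ext l k
  simp only [curvatureMatrix, riemannComponents, connectionMatrix, partialMatrix, Matrix.of_apply,
    Matrix.sub_apply, Matrix.add_apply, Matrix.mul_apply, Finset.sum_sub_distrib]
  simp only [mul_comm, add_sub_assoc]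

theorem smoothEntriesAt_connectionMatrix (hG : SmoothEntriesAt G y) (hdet : (G y).det ≠ 0)
    (i : Fin m) : SmoothEntriesAt (connectionMatrix G i) y := fun k j => by
  simp only [connectionMatrix, Matrix.of_apply, christoffel]
  refine ContDiffAt.const_smul _ (ContDiffAt.sum fun l _ => (hG.inv hdet k l).mul ?_)
  exact (((hG j l).partialReal i).add ((hG i l).partialReal j)).sub ((hG i j).partialReal l)

theorem christoffel_symm (hsymm : ∀ z i j, G z i j = G z j i) (k i j : Fin m) :
    christoffel partialReal G k i j = christoffel partialReal G k j i := by
  ext y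
  unfold christoffel
  congr 1
  refine Finset.sum_congr rfl fun l _ => ?_
  simp only [hsymm _ i j]
  ring

theorem sum_mul_christoffel (hdet : (G y).det ≠ 0) (l i j : Fin m) :
    ∑ k, G y l k * christoffel partialReal G k i j y =
      1 / 2 * (partialReal i (fun z => G z j l) y + partialReal j (fun z => G z i l) y -
        partialReal l (fun z => G z i j) y) := by
  let v : Fin m → ℝ := fun l => partialReal i (fun z => G z j l) y +
    partialReal j (fun z => G z i l) y - partialReal l (fun z => G z i j) y
  have h : (fun k => christoffel partialReal G k i j y) = (1 / 2 : ℝ) • (G y)⁻¹.mulVec v := rfl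
  change (G y).mulVec (fun k => christoffel partialReal G k i j y) l = 1 / 2 * v l
  rw [h, Matrix.mulVec_smul, Matrix.mulVec_mulVec,
    Matrix.mul_nonsing_inv _ (isUnit_iff_ne_zero.2 hdet), Matrix.one_mulVec]
  rfl

/-- The Levi-Civita connection is metric. -/
theorem partialMatrix_metric (hsymm : ∀ z i j, G z i j = G z j i) (hdet : (G y).det ≠ 0)
    (i : Fin m) : partialMatrix i G y =
      (connectionMatrix G i y).transpose * G y + G y * connectionMatrix G i y := by
  ext a b
  have h1 := sum_mul_christoffel hdet a i b
  have h2 := sum_mul_christoffel hdet b i a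
  have hs : ∀ a b, (fun z => G z a b) = fun z => G z b a := fun a b => funext fun z => hsymm z a b
  rw [hs b a] at h1
  rw [hs i a] at h1
  rw [hs i b] at h2
  simp only [partialMatrix, connectionMatrix, Matrix.of_apply, Matrix.add_apply, Matrix.mul_apply,
    Matrix.transpose_apply, hsymm y _ b]
  simp only [mul_comm (G y b _)] at h2
  rw [h1, h2, hs i a, hs i b]
  ring

/-- The curvature matrices are skew with respect to the metric. -/
theorem curvatureMatrix_metric (hsymm : ∀ z i j, G z i j = G z j i) (hG : SmoothEntriesAt G y)
    (hdet : ∀ᶠ z in nhds y, (G z).det ≠ 0) (i j : Fin m) :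
    (curvatureMatrix G y i j).transpose * G y + G y * curvatureMatrix G y i j = 0 := by
  have hΓ := smoothEntriesAt_connectionMatrix hG hdet.self_of_nhds
  -- Integrability with F = G, A_i = Γ_iᵀ and B_i = Γ_i: the A-part is the transposed curvature, the
  -- B-part the curvature.
  rw [← partialMatrix_integrability hG (fun i => (hΓ i).transpose) hΓ
    (fun i => hdet.mono fun z hz => partialMatrix_metric hsymm hz i) i j, curvatureMatrix_eq]
  simp only [Matrix.transpose_sub, Matrix.transpose_add, Matrix.transpose_mul]
  rfl

/-- The curvature matrices commute with a parallel endomorphism field. -/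
theorem curvatureMatrix_comm {J : EuclideanSpace ℝ (Fin m) → Matrix (Fin m) (Fin m) ℝ}
    (hG : SmoothEntriesAt G y) (hJ : SmoothEntriesAt J y) (hdet : (G y).det ≠ 0)
    (hpar : ∀ i, ∀ᶠ z in nhds y, partialMatrix i J z +
      (connectionMatrix G i z * J z - J z * connectionMatrix G i z) = 0) (i j : Fin m) :
    J y * curvatureMatrix G y i j = curvatureMatrix G y i j * J y := by
  have hΓ := smoothEntriesAt_connectionMatrix hG hdet
  -- Here F = J, A_i = -Γ_i and B_i = Γ_i, so the A-part is minus the curvature.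
  have h := partialMatrix_integrability hJ (fun i => (hΓ i).neg) hΓ
    (fun i => (hpar i).mono fun z hz => by
      rw [eq_neg_of_add_eq_zero_left hz]; noncomm_ring) i j
  rw [← sub_eq_zero, ← h, curvatureMatrix_eq]
  simp only [partialMatrix_neg]
  noncomm_ring

theorem riemannComponents_antisymm (l k i j : Fin m) :
    riemannComponents partialReal G y l k i j = -riemannComponents partialReal G y l k j i := by
  simp only [riemannComponents, Finset.sum_sub_distrib]
  ring

/-- Symmetry of Γ in its lower indices (no torsion) makes the cyclic sum cancel in pairs. -/
theorem riemannComponents_bianchi (hsymm : ∀ z i j, G z i j = G z j i) (l k i j : Fin m) :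
    riemannComponents partialReal G y l k i j + riemannComponents partialReal G y l i j k +
      riemannComponents partialReal G y l j k i = 0 := by
  simp only [riemannComponents, Finset.sum_sub_distrib]
  rw [christoffel_symm hsymm l k j, christoffel_symm hsymm l k i, christoffel_symm hsymm l j i]
  simp only [fun p => christoffel_symm hsymm p k j, fun p => christoffel_symm hsymm p k i,
    fun p => christoffel_symm hsymm p j i]
  ring

theorem inv_map_algebraMap (A : Matrix (Fin m) (Fin m) ℝ) :
    (A.map (algebraMap ℝ ParaComplex))⁻¹ = A⁻¹.map (algebraMap ℝ ParaComplex) := by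
  have hdet : (A.map (algebraMap ℝ ParaComplex)).det = algebraMap ℝ ParaComplex A.det :=
    ((algebraMap ℝ ParaComplex).map_det A).symm
  have hinv : ∀ r : ℝ, Ring.inverse (algebraMap ℝ ParaComplex r) =
      algebraMap ℝ ParaComplex r⁻¹ := by
    intro r
    -- For r = 0 both inverses take the default value 0, so no invertibility hypothesis is needed;
    -- for r ≠ 0 the image is a unit of C, which is not a field.
    by_cases hr : r = 0
    · simp [hr]
    · have h : algebraMap ℝ ParaComplex r * algebraMap ℝ ParaComplex r⁻¹ = 1 := by
        rw [← map_mul, mul_inv_cancel₀ hr, map_one]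
      have hu : IsUnit (algebraMap ℝ ParaComplex r) := IsUnit.of_mul_eq_one _ h
      rw [← hu.mul_right_inj, Ring.mul_inverse_cancel _ hu, h]
  rw [Matrix.inv_def, Matrix.inv_def, hdet, hinv, Ring.inverse_eq_inv']
  have hadj := (algebraMap ℝ ParaComplex).map_adjugate A
  simp only [RingHom.mapMatrix_apply] at hadj
  rw [← hadj]
  ext a b <;> simp

theorem christoffel_map_algebraMap (k i j : Fin m) :
    christoffel partialPara (fun z => (G z).map (algebraMap ℝ ParaComplex)) k i j =
      fun z => algebraMap ℝ ParaComplex (christoffel partialReal G k i j z) := by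
  ext1 y
  simp only [christoffel, inv_map_algebraMap, Matrix.map_apply, partialPara_algebraMap,
    Algebra.smul_def, map_mul, map_sum, map_add, map_sub, Algebra.algebraMap_self, RingHom.id_apply]

theorem riemannComponents_map_algebraMap (l k i j : Fin m) :
    riemannComponents partialPara (fun z => (G z).map (algebraMap ℝ ParaComplex)) y l k i j =
      algebraMap ℝ ParaComplex (riemannComponents partialReal G y l k i j) := by
  simp only [riemannComponents, christoffel_map_algebraMap, partialPara_algebraMap,
    map_mul, map_sum, map_add, map_sub]

end LeviCivita

/-! ### From component identities to tensor identities -/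

section Tensors

variable {m : ℕ}

theorem tensorOfComponents_basis {A V : Type*} [CommSemiring A] [AddCommMonoid V] [Module A V]
    (b : Module.Basis (Fin m) A V) (comp : Fin m → Fin m → Fin m → Fin m → A) (i j k : Fin m) :
    tensorOfComponents b comp (b i) (b j) (b k) = ∑ l, comp l k i j • b l := by
  simp [tensorOfComponents]

theorem Module.Basis.induction_on_span {ι A V : Type*} [Semiring A] [AddCommMonoid V] [Module A V]
    (b : Module.Basis ι A V) {p : V → Prop} (basis : ∀ i, p (b i)) (zero : p 0)
    (add : ∀ X Y, p X → p Y → p (X + Y)) (smul : ∀ (c : A) X, p X → p (c • X)) (X : V) : p X :=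
  Submodule.span_induction (p := fun X _ => p X) (by rintro _ ⟨i, rfl⟩; exact basis i) zero
    (fun X Y _ _ => add X Y) (fun c X _ => smul c X) (b.mem_span X)

theorem tensorOfComponents_baseChange {V : Type*} [AddCommGroup V] [Module ℝ V]
    (b : Module.Basis (Fin m) ℝ V) (comp : Fin m → Fin m → Fin m → Fin m → ℝ) (X Y Z : V) :
    tensorOfComponents (b.baseChange ParaComplex)
        (fun l k i j => algebraMap ℝ ParaComplex (comp l k i j))
        ((1 : ParaComplex) ⊗ₜ[ℝ] X) ((1 : ParaComplex) ⊗ₜ[ℝ] Y) ((1 : ParaComplex) ⊗ₜ[ℝ] Z) =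
      (1 : ParaComplex) ⊗ₜ[ℝ] tensorOfComponents b comp X Y Z := by
  have hs : ∀ (c : ℝ) (X : V), (1 : ParaComplex) ⊗ₜ[ℝ] (c • X) =
      algebraMap ℝ ParaComplex c • ((1 : ParaComplex) ⊗ₜ[ℝ] X) := by
    intro c X
    rw [TensorProduct.tmul_smul, algebraMap_smul]
  induction X using b.induction_on_span with
  | zero => simp
  | add X X' h h' => simp only [TensorProduct.tmul_add, map_add, LinearMap.add_apply, h, h']
  | smul c X h => simp only [hs, map_smul, LinearMap.smul_apply, h]
  | basis i =>
  induction Y using b.induction_on_span with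
  | zero => simp
  | add X X' h h' => simp only [TensorProduct.tmul_add, map_add, LinearMap.add_apply, h, h']
  | smul c X h => simp only [hs, map_smul, LinearMap.smul_apply, h]
  | basis j =>
  induction Z using b.induction_on_span with
  | zero => simp
  | add X X' h h' => simp only [TensorProduct.tmul_add, map_add, h, h']
  | smul c X h => simp only [hs, map_smul, h]
  | basis k =>
  have h1 : ∀ i, (1 : ParaComplex) ⊗ₜ[ℝ] b i = b.baseChange ParaComplex i := fun i => by simp
  rw [h1, h1, h1, tensorOfComponents_basis, tensorOfComponents_basis, TensorProduct.tmul_sum]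
  simp only [hs, h1]

/-- Each symmetry is linear in every argument, so it suffices to test basis vectors, where it
becomes an identity between components or matrix entries. -/
theorem ParaNordenSpace.isParaKahlerCurvature_of_components {V : Type*} [AddCommGroup V]
    [Module ℝ V] (P : ParaNordenSpace V) (b : Module.Basis (Fin m) ℝ V)
    {comp : Fin m → Fin m → Fin m → Fin m → ℝ} {G J : Matrix (Fin m) (Fin m) ℝ}
    (hG : ∀ i j, P.B (b i) (b j) = G i j) (hJ : ∀ j, P.J (b j) = ∑ k, J k j • b k)
    (antisymm : ∀ l k i j, comp l k i j = -comp l k j i)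
    (bianchi : ∀ l k i j, comp l k i j + comp l i j k + comp l j k i = 0)
    (skew : ∀ i j, (Matrix.of fun l k => comp l k i j).transpose * G +
      G * (Matrix.of fun l k => comp l k i j) = 0)
    (comm : ∀ i j, J * (Matrix.of fun l k => comp l k i j) =
      (Matrix.of fun l k => comp l k i j) * J) :
    P.IsParaKahlerCurvature (tensorOfComponents b comp) where
  antisymm X Y Z := by
    induction X using b.induction_on_span with
    | zero => simp
    | add X X' h h' => simp only [map_add, LinearMap.add_apply, h, h', neg_add]
    | smul c X h => simp only [map_smul, LinearMap.smul_apply, h, smul_neg]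
    | basis i =>
    induction Y using b.induction_on_span with
    | zero => simp
    | add X X' h h' => simp only [map_add, LinearMap.add_apply, h, h', neg_add]
    | smul c X h => simp only [map_smul, LinearMap.smul_apply, h, smul_neg]
    | basis j =>
    induction Z using b.induction_on_span with
    | zero => simp
    | add X X' h h' => simp only [map_add, h, h', neg_add]
    | smul c X h => simp only [map_smul, h, smul_neg]
    | basis k =>
    rw [tensorOfComponents_basis, tensorOfComponents_basis, ← Finset.sum_neg_distrib]
    exact Finset.sum_congr rfl fun l _ => by rw [antisymm, neg_smul]
  bianchi X Y Z := by
    induction X using b.induction_on_span with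
    | zero => simp
    | add X X' h h' =>
      have := congrArg₂ (· + ·) h h'
      rw [add_zero] at this
      rw [← this]
      simp only [map_add, LinearMap.add_apply]
      abel
    | smul c X h => simp only [map_smul, LinearMap.smul_apply, ← smul_add, h, smul_zero]
    | basis i =>
    induction Y using b.induction_on_span with
    | zero => simp
    | add X X' h h' =>
      have := congrArg₂ (· + ·) h h'
      rw [add_zero] at this
      rw [← this]
      simp only [map_add, LinearMap.add_apply]
      abel
    | smul c X h => simp only [map_smul, LinearMap.smul_apply, ← smul_add, h, smul_zero]
    | basis j =>
    induction Z using b.induction_on_span with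
    | zero => simp
    | add X X' h h' =>
      have := congrArg₂ (· + ·) h h'
      rw [add_zero] at this
      rw [← this]
      simp only [map_add, LinearMap.add_apply]
      abel
    | smul c X h => simp only [map_smul, LinearMap.smul_apply, ← smul_add, h, smul_zero]
    | basis k =>
    rw [tensorOfComponents_basis, tensorOfComponents_basis, tensorOfComponents_basis,
      ← Finset.sum_add_distrib, ← Finset.sum_add_distrib]
    exact Finset.sum_eq_zero fun l _ => by rw [← add_smul, ← add_smul, bianchi, zero_smul]
  map_J X Y Z := by
    induction X using b.induction_on_span with
    | zero => simp
    | add X X' h h' => simp only [map_add, LinearMap.add_apply, h, h']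
    | smul c X h => simp only [map_smul, LinearMap.smul_apply, h]
    | basis i =>
    induction Y using b.induction_on_span with
    | zero => simp
    | add X X' h h' => simp only [map_add, LinearMap.add_apply, h, h']
    | smul c X h => simp only [map_smul, LinearMap.smul_apply, h]
    | basis j =>
    induction Z using b.induction_on_span with
    | zero => simp
    | add X X' h h' => simp only [map_add, h, h']
    | smul c X h => simp only [map_smul, h]
    | basis k =>
    rw [hJ, map_sum, tensorOfComponents_basis, map_sum]
    simp only [map_smul, tensorOfComponents_basis, hJ, Finset.smul_sum, smul_smul]
    -- After exchanging the sums, the coefficients of b_l on the two sides are the (l, k) entries of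
    -- the products of J with the curvature matrix.
    rw [Finset.sum_comm]
    conv_rhs => rw [Finset.sum_comm]
    refine Finset.sum_congr rfl fun l _ => ?_
    have h := congrFun (congrFun (comm i j) l) k
    simp only [Matrix.mul_apply, Matrix.of_apply] at h
    rw [← Finset.sum_smul, ← Finset.sum_smul]
    simp only [mul_comm] at h ⊢
    rw [h]
  skew X Y Z W := by
    induction X using b.induction_on_span with
    | zero => simp
    | add X X' h h' => simp only [map_add, LinearMap.add_apply, h, h', neg_add]
    | smul c X h => simp only [map_smul, LinearMap.smul_apply, h, smul_neg]
    | basis i =>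
    induction Y using b.induction_on_span with
    | zero => simp
    | add X X' h h' => simp only [map_add, LinearMap.add_apply, h, h', neg_add]
    | smul c X h => simp only [map_smul, LinearMap.smul_apply, h, smul_neg]
    | basis j =>
    induction Z using b.induction_on_span with
    | zero => simp
    | add X X' h h' => simp only [map_add, LinearMap.add_apply, h, h', neg_add]
    | smul c X h => simp only [map_smul, LinearMap.smul_apply, h, smul_neg]
    | basis k =>
    induction W using b.induction_on_span with
    | zero => simp
    | add X X' h h' => simp only [map_add, LinearMap.add_apply, h, h', neg_add]
    | smul c X h => simp only [map_smul, LinearMap.smul_apply, h, smul_neg]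
    | basis n =>
    have h := congrFun (congrFun (skew i j) k) n
    have hsymm : ∀ l, G k l = G l k := fun l => by rw [← hG, ← hG, P.B_symm]
    simp only [Matrix.add_apply, Matrix.mul_apply, Matrix.transpose_apply, Matrix.of_apply,
      Matrix.zero_apply] at h
    rw [tensorOfComponents_basis, tensorOfComponents_basis, eq_neg_iff_add_eq_zero, ← h]
    simp only [map_sum, map_smul, LinearMap.sum_apply, LinearMap.smul_apply, hG, smul_eq_mul,
      hsymm, mul_comm]

end Tensors


/-! ### Components of the metric and of I in charts -/

section Charts

variable {m : ℕ} {M : Type*} [TopologicalSpace M] [ChartedSpace (EuclideanSpace ℝ (Fin m)) M]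
  [IsManifold (𝓡 m) ∞ M]

/-- The tangent space at x is identified with the model space through the chart at x, so the inverse
chart has derivative the identity there. Hence the coordinate frame at x is `tangentBasis x`. -/
theorem mfderiv_extChartAt_symm_self (x : M) :
    mfderiv 𝓘(ℝ, EuclideanSpace ℝ (Fin m)) (𝓡 m) (extChartAt (𝓡 m) x).symm
      (extChartAt (𝓡 m) x x) = ContinuousLinearMap.id ℝ (EuclideanSpace ℝ (Fin m)) := by
  have : IsManifold (𝓡 m) 1 M := .of_le (n := ∞) (by simp)
  have h := mfderivWithin_range_extChartAt_symm (I := 𝓡 m) (x := x)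
  rw [ModelWithCorners.range_eq_univ, mfderivWithin_univ] at h
  exact h

theorem coordVec_self (x : M) (i : Fin m) :
    (coordVec x (extChartAt (𝓡 m) x x) i : EuclideanSpace ℝ (Fin m)) = tangentBasis x i := by
  have h := congrArg (fun L : EuclideanSpace ℝ (Fin m) →L[ℝ] EuclideanSpace ℝ (Fin m) =>
    L (EuclideanSpace.single i 1)) (mfderiv_extChartAt_symm_self x)
  exact h.trans (OrthonormalBasis.coe_toBasis (EuclideanSpace.basisFun (Fin m) ℝ) ▸
    (EuclideanSpace.basisFun_apply (Fin m) ℝ i).symm)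

theorem ParaNordenMetric.components_self {S : ParaComplexStructure m M} (g : ParaNordenMetric S)
    (x : M) (i j : Fin m) : g.components x (extChartAt (𝓡 m) x x) i j =
      g.g x (tangentBasis x i) (tangentBasis x j) := by
  -- The point with the coordinates of x equals x only propositionally; a free z allows substitution
  -- inside the dependent tangent spaces.
  have key : ∀ (z : M) (_ : z = x) (u v u' v' : EuclideanSpace ℝ (Fin m)), u = u' → v = v' →
      g.g z u v = g.g x u' v' := by
    rintro z rfl u v u' v' rfl rfl
    rfl
  exact key _ (extChartAt_to_inv x) _ _ _ _ (coordVec_self x i) (coordVec_self x j)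

theorem ParaComplexStructure.components_self (S : ParaComplexStructure m M) (x : M)
    (k j : Fin m) : S.components x (extChartAt (𝓡 m) x x) k j =
      (tangentBasis x).repr (S.I x (tangentBasis x j)) k := by
  have : IsManifold (𝓡 m) 1 M := .of_le (n := ∞) (by simp)
  have key : ∀ (z : M) (_ : z = x) (u u' : EuclideanSpace ℝ (Fin m)), u = u' →
      (mfderiv (𝓡 m) 𝓘(ℝ, EuclideanSpace ℝ (Fin m)) (extChartAt (𝓡 m) x) z (S.I z u) :
        EuclideanSpace ℝ (Fin m)) = S.I x u' := by
    rintro z rfl u u' rfl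
    exact congrArg (fun L : EuclideanSpace ℝ (Fin m) →L[ℝ] EuclideanSpace ℝ (Fin m) =>
      L (S.I z u)) (mfderiv_extChartAt_self (I := 𝓡 m) (x := z))
  exact congrArg (fun v : EuclideanSpace ℝ (Fin m) => v k)
    (key _ (extChartAt_to_inv x) _ _ (coordVec_self x j))

/-- The coordinate vector fields are smooth. -/
theorem contMDiffOn_coordVec (c : M) (i : Fin m) :
    ContMDiffOn 𝓘(ℝ, EuclideanSpace ℝ (Fin m)) (𝓡 m).tangent ∞
      (fun y => (⟨(extChartAt (𝓡 m) c).symm y, coordVec c y i⟩ : TangentBundle (𝓡 m) M))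
      (extChartAt (𝓡 m) c).target := by
  have : IsManifold (𝓡 m) 1 M := .of_le (n := ∞) (by simp)
  have ho := isOpen_extChartAt_target (I := 𝓡 m) c
  have h1 := (contMDiffOn_extChartAt_symm (I := 𝓡 m) (n := ∞) c).contMDiffOn_tangentMapWithin
    (m := ∞) (by simp) ho.uniqueMDiffOn
  have h2 : ContMDiff 𝓘(ℝ, EuclideanSpace ℝ (Fin m)) 𝓘(ℝ, EuclideanSpace ℝ (Fin m)).tangent ∞
      (fun y => (⟨y, (EuclideanSpace.single i (1 : ℝ) : EuclideanSpace ℝ (Fin m))⟩ :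
        TangentBundle 𝓘(ℝ, EuclideanSpace ℝ (Fin m)) (EuclideanSpace ℝ (Fin m)))) := fun y =>
    contMDiffAt_vectorSpace_iff_contDiffAt.2 contDiffAt_const
  refine (h1.comp h2.contMDiffOn fun y hy => hy).congr fun y hy => ?_
  simp only [Function.comp_apply, tangentMapWithin, mfderivWithin_of_isOpen ho hy]
  rfl

omit [IsManifold (𝓡 m) ∞ M] in
theorem contDiffAt_of_contMDiffOn_target {c : M} {F : Type*} [NormedAddCommGroup F]
    [NormedSpace ℝ F] {f : EuclideanSpace ℝ (Fin m) → F}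
    (hf : ContMDiffOn 𝓘(ℝ, EuclideanSpace ℝ (Fin m)) 𝓘(ℝ, F) ∞ f (extChartAt (𝓡 m) c).target)
    {y : EuclideanSpace ℝ (Fin m)} (hy : y ∈ (extChartAt (𝓡 m) c).target) :
    ContDiffAt ℝ ∞ f y :=
  (hf.contDiffOn y hy).contDiffAt ((isOpen_extChartAt_target (I := 𝓡 m) c).mem_nhds hy)

theorem ParaNordenMetric.smoothEntriesAt_components {S : ParaComplexStructure m M}
    (g : ParaNordenMetric S) (c : M) {y : EuclideanSpace ℝ (Fin m)}
    (hy : y ∈ (extChartAt (𝓡 m) c).target) : SmoothEntriesAt (g.components c) y := by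
  intro i j
  have : IsManifold (𝓡 m) 1 M := .of_le (n := ∞) (by simp)
  refine contDiffAt_of_contMDiffOn_target ?_ hy
  have hg := g.contMDiff_g.comp_contMDiffOn (contMDiffOn_extChartAt_symm (I := 𝓡 m) (n := ∞) c)
  have h := ContMDiffOn.clm_bundle_apply₂ (F₃ := ℝ) (E₃ := Bundle.Trivial M ℝ) hg
    (contMDiffOn_coordVec c i) (contMDiffOn_coordVec c j)
  intro z hz
  exact (contMDiffWithinAt_totalSpace.1 (h z hz)).2

theorem ParaComplexStructure.smoothEntriesAt_components (S : ParaComplexStructure m M) (c : M)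
    {y : EuclideanSpace ℝ (Fin m)} (hy : y ∈ (extChartAt (𝓡 m) c).target) :
    SmoothEntriesAt (fun z => Matrix.of (S.components c z)) y := by
  intro k j
  have : IsManifold (𝓡 m) 1 M := .of_le (n := ∞) (by simp)
  have hI := S.contMDiff_I.comp_contMDiffOn (contMDiffOn_extChartAt_symm (I := 𝓡 m) (n := ∞) c)
  have h := ContMDiffOn.clm_bundle_apply hI (contMDiffOn_coordVec c j)
  have h1 := (contMDiffOn_extChartAt (I := 𝓡 m) (n := ∞) (x := c)).contMDiffOn_tangentMapWithin
    (m := ∞) (by simp) (chartAt _ c).open_source.uniqueMDiffOn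
  have h2 := h1.comp h fun z hz => by
    simpa using (extChartAt (𝓡 m) c).map_target hz
  have h3 := (contMDiff_snd_tangentBundle_modelSpace (n := ∞) (EuclideanSpace ℝ (Fin m))
    𝓘(ℝ, EuclideanSpace ℝ (Fin m))).comp_contMDiffOn h2
  have h4 := contDiffAt_of_contMDiffOn_target h3 hy
  have h5 := (EuclideanSpace.proj k : EuclideanSpace ℝ (Fin m) →L[ℝ] ℝ).contDiff.contDiffAt.comp y
    h4
  refine h5.congr_of_eventuallyEq ?_
  filter_upwards [(isOpen_extChartAt_target (I := 𝓡 m) c).mem_nhds hy] with z hz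
  have hz' := (extChartAt (𝓡 m) c).map_target hz
  rw [extChartAt_source] at hz'
  exact congrArg (fun L : EuclideanSpace ℝ (Fin m) →L[ℝ] EuclideanSpace ℝ (Fin m) =>
    L (S.I _ (coordVec c z j)) k) (mfderivWithin_of_isOpen (chartAt _ c).open_source hz').symm

/-- The derivative of the inverse chart is invertible, so the coordinate vectors form a basis, and
the components are the Gram matrix of a nondegenerate form. -/
theorem ParaNordenMetric.det_components_ne_zero {S : ParaComplexStructure m M}
    (g : ParaNordenMetric S) (c : M) {y : EuclideanSpace ℝ (Fin m)}
    (hy : y ∈ (extChartAt (𝓡 m) c).target) : (g.components c y).det ≠ 0 := by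
  have : IsManifold (𝓡 m) 1 M := .of_le (n := ∞) (by simp)
  have hinv := isInvertible_mfderivWithin_extChartAt_symm (I := 𝓡 m) hy
  rw [ModelWithCorners.range_eq_univ, mfderivWithin_univ] at hinv
  obtain ⟨L, hL⟩ := hinv
  let b : Module.Basis (Fin m) ℝ (TangentSpace (𝓡 m) ((extChartAt (𝓡 m) c).symm y)) :=
    (EuclideanSpace.basisFun (Fin m) ℝ).toBasis.map L.toLinearEquiv
  have hb : ∀ i, b i = coordVec c y i := by
    intro i
    have e : (EuclideanSpace.basisFun (Fin m) ℝ).toBasis i = EuclideanSpace.single i 1 := by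
      simp
    exact (congrArg (fun v : EuclideanSpace ℝ (Fin m) => L v) e).trans
      (congrArg (fun T : EuclideanSpace ℝ (Fin m) →L[ℝ] EuclideanSpace ℝ (Fin m) =>
        T (EuclideanSpace.single i 1)) hL)
  have h : g.components c y =
      LinearMap.BilinForm.toMatrix b (g.tangent ((extChartAt (𝓡 m) c).symm y)).B := by
    ext i j
    rw [LinearMap.BilinForm.toMatrix_apply, hb, hb]
    rfl
  rw [h]
  exact (LinearMap.BilinForm.nondegenerate_iff_det_ne_zero b).1 (g.tangent _).B_nondeg

end Charts

/-! ### Curvature of g and of ĝ, and the scalar curvature formula -/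

namespace ParaNordenMetric

variable {m : ℕ} {M : Type*} [TopologicalSpace M] [ChartedSpace (EuclideanSpace ℝ (Fin m)) M]
  [IsManifold (𝓡 m) ∞ M] {S : ParaComplexStructure m M} (g : ParaNordenMetric S)

/-- The curvature tensor of a para-Kähler Norden manifold has the para-Kähler symmetries. -/
theorem isParaKahlerCurvature_riemann (hg : g.IsParaKahler) (x : M) :
    (g.tangent x).IsParaKahlerCurvature (g.riemann x) := by
  have hx := mem_extChartAt_target (I := 𝓡 m) x
  have hnhds := (isOpen_extChartAt_target (I := 𝓡 m) x).mem_nhds hx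
  have hsymm : ∀ z i j, g.components x z i j = g.components x z j i := fun z i j => g.symm _ _ _
  have hG := g.smoothEntriesAt_components x hx
  have hJ := S.smoothEntriesAt_components x hx
  refine (g.tangent x).isParaKahlerCurvature_of_components (tangentBasis x)
    (G := g.components x (extChartAt (𝓡 m) x x))
    (J := Matrix.of (S.components x (extChartAt (𝓡 m) x x)))
    (fun i j => (g.components_self x i j).symm) (fun j => ?_)
    (fun l k i j => riemannComponents_antisymm l k i j)
    (fun l k i j => riemannComponents_bianchi hsymm l k i j)
    (fun i j => curvatureMatrix_metric hsymm hG ?_ i j)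
    (fun i j => curvatureMatrix_comm hG hJ (g.det_components_ne_zero x hx) (fun i => ?_) i j)
  · simp only [Matrix.of_apply, S.components_self]
    exact ((tangentBasis x).sum_repr _).symm
  · filter_upwards [hnhds] with z hz using g.det_components_ne_zero x hz
  · filter_upwards [hnhds] with z hz
    ext k j
    have h := hg x z hz i j k
    rw [Finset.sum_sub_distrib] at h
    simp only [Matrix.add_apply, Matrix.sub_apply, Matrix.mul_apply, Matrix.zero_apply,
      partialMatrix, connectionMatrix, Matrix.of_apply, mul_comm (S.components x z k _)]
    exact h

theorem hatComponents_eq (c : M) : g.hatComponents c =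
    fun y => (g.components c y).map (algebraMap ℝ ParaComplex) := by
  ext1 y
  ext1 i j
  exact ParaNordenSpace.formC_one_tmul _ _ _

/-- The curvature tensor of `ĝ` is the `C`-trilinear extension of that of `g`. -/
theorem hatRiemann_one_tmul (x : M) (X Y Z : TangentSpace (𝓡 m) x) :
    g.hatRiemann x ((1 : ParaComplex) ⊗ₜ[ℝ] X) ((1 : ParaComplex) ⊗ₜ[ℝ] Y)
      ((1 : ParaComplex) ⊗ₜ[ℝ] Z) = (1 : ParaComplex) ⊗ₜ[ℝ] g.riemann x X Y Z := by
  have h : riemannComponents partialPara (g.hatComponents x) (extChartAt (𝓡 m) x x) =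
      fun l k i j => algebraMap ℝ ParaComplex
        (riemannComponents partialReal (g.components x) (extChartAt (𝓡 m) x x) l k i j) := by
    funext l k i j
    rw [hatComponents_eq, riemannComponents_map_algebraMap]
  rw [hatRiemann, h]
  exact tensorOfComponents_baseChange _ _ _ _ _

end ParaNordenMetric

end
theorem mainTheorem10 {m : ℕ} {M : Type*} [TopologicalSpace M]
    [ChartedSpace (EuclideanSpace ℝ (Fin m)) M] [IsManifold (𝓡 m) ∞ M]
    (S : ParaComplexStructure m M) (g : ParaNordenMetric S) (hg : g.IsParaKahler) (x : M) :
    (∀ Z₁ ∈ g.T10 x, ∀ Z₂ ∈ g.T10 x, ∀ Z₃ ∈ g.T10 x, g.hatRiemann x Z₁ Z₂ Z₃ ∈ g.T10 x) ∧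
    g.hatScalarCurvature x =
      (1 / 2 : ℝ) • (algebraMap ℝ ParaComplex (g.scalarCurvature x) +
        ParaComplex.e * algebraMap ℝ ParaComplex (g.scalarCurvatureStar x)) := by
  have hR := g.isParaKahlerCurvature_riemann hg x
  have hRC := g.hatRiemann_one_tmul x
  refine ⟨fun Z₁ _ Z₂ _ Z₃ h => (g.tangent x).extension_mem_T10 hR hRC Z₁ Z₂ Z₃ h, ?_⟩
  have h10 : ∀ X Y Z, g.hatRiemann10 x ((g.tangent x).hat X) ((g.tangent x).hat Y)
      ((g.tangent x).hat Z) = (g.tangent x).hat (g.riemann x X Y Z) := by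
    intro X Y Z
    -- The projection built into `hatRiemann10` is harmless, since the value already lies in
    -- T^{1,0}.
    exact (congrArg (g.tangent x).proj10 ((g.tangent x).extension_hat hR hRC X Y Z)).trans
      ((g.tangent x).proj10_coe _)
  refine ((g.tangent x).trace_ricciOp hR h10).trans ?_
  change (⟨1 / 2 * g.scalarCurvature x, 1 / 2 * g.scalarCurvatureStar x⟩ : ParaComplex) = _
  ext <;> simp
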